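/- Theorem (right free Clark intertwining). Let $\mathcal H$ be a complex Hilbert space, $d\in\mathbb N$, $\mathbb F^d$ the free monoid of words in $d$ letters (empty word $\emptyset$, transpose $\alpha\mapsto\alpha^T$), and $F^2_d\otimes\mathcal H$ the full Fock space, viewed as the space of formal power series $F(Z)=\sum_\alpha Z^\alpha F_\alpha$ in $d$ non-commuting variables with square-summable coefficients $F_\alpha\in\mathcal H$; $L=(L_1,\dots,L_d)$ are the left creation operators, and $M(Z)\bullet_R F(Z)=\sum_{\alpha,\beta}Z^{\beta\alpha}M_\alpha F_\beta$. Let $B=(B^L,B^R)$ be a transpose-conjugate pair of free Schur multipliers: $B^L(Z)=\sum_\alpha Z^\alpha B_{\alpha}$ and $B^R(Z)=\sum_\alpha Z^{\alpha}B_{\alpha^T}$ with $B_\alpha\in\mathcal L(\mathcal H)$, left multiplication by $B^L$ and right multiplication by $B^R$ being contractions of $F^2_d\otimes\mathcal H$. Assume that $B$ is non-unital, i.e. that $I-B_\emptyset$ is invertible (for a Schur multiplier this is the same as invertibility of $I-B^L(Z)$ and $I-B^R(Z)$ for all strict row contractions $Z$). Let $\hat k(Z,W)=\sum_\alpha Z^\alpha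 (W^*)^{\alpha^T}$, let $\mathscr H^R(B)$ be the reproducing kernel Hilbert space of $\mathcal H$-valued formal power series with kernel $\hat k^R(Z,W)=\hat k(Z,W)-B^R(Z)\bullet_R\hat k(Z,W)\bullet_R B^R(W)^*$, and let $\hat k^R_\alpha:\mathcal H\to\mathscr H^R(B)$ be the adjoint of the coefficient evaluation $F\mapsto F_\alpha$. Let $H^L=(I-B^L)^{-1}(I+B^L)$ and $H^R=(I-B^R)^{-1}\bullet_R(I+B^R)$, and let $\mathscr H^{R,+}(H_B)$ be the reproducing kernel Hilbert space with kernel $\hat K^R(Z,W)=\frac12\big(H^R(Z)\bullet_R\hat k(Z,W)+\hat k(Z,W)\bullet_R H^R(W)^*\big)$, with coefficient maps $\hat K^R_\alpha$ defined in the same way. There is a unique completely positive map $\mu_B$ from the norm closure of $\mathcal A+\mathcal A^*$ to $\mathcal L(\mathcal H)$, where $\mathcal A$ is the norm-closed unital algebra generated by $L_1,\dots,L_d$ on $F^2_d$, such that $\mu_B(I)=\operatorname{Re}H^L_\emptyset$ and $\mu_B(L^{\alpha^T})^*=\frac12H^L_\alpha$ for $\alpha\ne\emptyset$. Let $F^2(\mu_B)$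 be the Hilbert space obtained from $\mathcal A\otimes\mathcal H$ with the semi-inner product $\langle a\otimes h,b\otimes g\rangle=\langle h,\mu_B(a^*b)g\rangle$ by dividing out null vectors and completing, and let $\pi_B(a)(b\otimes h)=ab\otimes h$. There is a unique unitary (the weighted right free Cauchy transform) $\hat{\mathcal F}_R:F^2(\mu_B)\to\mathscr H^R(B)$ which is the composition of a unitary $\hat{\mathcal C}_R:F^2(\mu_B)\to\mathscr H^{R,+}(H_B)$ with $\hat{\mathcal C}_R(\pi_B(L)^\alpha(I\otimes h))=\hat K^R_\alpha h$ and of the operator of right multiplication by $I-B^R(Z)$, which is unitary from $\mathscr H^{R,+}(H_B)$ onto $\mathscr H^R(B)$. The space $\mathscr H^R(B)$ is contractively contained in $F^2_d\otimes\mathcal H$ and invariant under each $L_j^*\otimes I_{\mathcal H}$, and this gives a bounded operator $(L^*\otimes I_{\mathcal H})|_{\mathscr H^R(B)}:\mathscr H^R(B)\to\mathscr H^R(B)\otimes\mathbb C^d$. The formula $\mathbf B^R=(L^*\otimes I_{\mathcal H})B^R$, i.e. $\mathbf B^Rh=\big((L_j^*\otimes I_{\mathcal H})B^Rh\big)_{j=1}^d$,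 defines a bounded operator $\mathbf B^R:\mathcal H\to\mathscr H^R(B)\otimes\mathbb C^d$, which is the unique contractive Gleason solution for $B^R$: the unique bounded operator with $\sum_jZ_j\mathbf B^R_j(Z)=B^R(Z)-B_\emptyset$ and $(\mathbf B^R)^*\mathbf B^R\le I-B_\emptyset^*B_\emptyset$. Finally, with $\pi_B(L)=(\pi_B(L_1),\dots,\pi_B(L_d)):F^2(\mu_B)\otimes\mathbb C^d\to F^2(\mu_B)$, $$(\hat{\mathcal F}_R\otimes I_d)\,\pi_B(L)^*\,\hat{\mathcal F}_R^*=(L^*\otimes I_{\mathcal H})|_{\mathscr H^R(B)}+\mathbf B^R(I-B_\emptyset)^{-1}(\hat k^R_\emptyset)^*,$$ and this operator $\mathscr H^R(B)\to\mathscr H^R(B)\otimes\mathbb C^d$ is a co-isometry. -/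

import Mathlib

noncomputable section

open scoped ENNReal ComplexConjugate InnerProductSpace ComplexOrder TensorProduct

namespace FreeClark

/-- Words in the letters `1, …, d`, i.e. the free monoid on `d` generators: the product is
concatenation `++`, the unit is `[]` and the transpose of a word is `List.reverse`. -/
abbrev Word (d : ℕ) := List (Fin d)

/-- The `E`-valued full Fock space `F²_d ⊗ E` over `ℂ^d`: square-summable families of coefficients
indexed by words. -/
abbrev Fock (d : ℕ) (E : Type*) [NormedAddCommGroup E] := lp (fun _ : Word d => E) 2

section Fock

variable {d : ℕ} {E : Type*} [NormedAddCommGroup E]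

/-- Coefficients of `Z_j F(Z)`: the coefficient of `F` at `α` is moved to the word `jα`. -/
def consCoeff (j : Fin d) (F : Word d → E) : Word d → E
  | [] => 0
  | i :: α => if i = j then F α else 0

theorem consCoeff_eq_zero (j : Fin d) (F : Word d → E) (α : Word d)
    (h : α ∉ Set.range (List.cons j)) : consCoeff j F α = 0 := by
  cases α with
  | nil => rfl
  | cons i α =>
    by_cases hij : i = j
    · exact absurd ⟨α, by rw [hij]⟩ h
    · simp [consCoeff, hij]

theorem consCoeff_cons (j : Fin d) (F : Word d → E) (α : Word d) :
    consCoeff j F (j :: α) = F α := by simp [consCoeff]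

theorem consCoeff_hasSum (j : Fin d) (F : Fock d E) :
    HasSum (fun α => ‖consCoeff j F α‖ ^ 2) (‖F‖ ^ 2) := by
  have h := lp.hasSum_norm (p := 2) (by norm_num) F
  simp only [ENNReal.toReal_ofNat, Real.rpow_ofNat] at h
  refine (Function.Injective.hasSum_iff (List.cons_injective (a := j)) ?_).1 ?_
  · intro α hα
    simp [consCoeff_eq_zero j F α hα]
  · convert h using 2 with α
    simp [consCoeff_cons]

theorem consCoeff_memℓp (j : Fin d) (F : Fock d E) : Memℓp (consCoeff j F) 2 := by
  refine memℓp_gen ?_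
  simpa using (consCoeff_hasSum j F).summable

/-- The left creation operator `L_j` (tensored with the identity of `E`), as an isometry. -/
def leftCreationₗᵢ (E : Type*) [NormedAddCommGroup E] [InnerProductSpace ℂ E] (j : Fin d) :
    Fock d E →ₗᵢ[ℂ] Fock d E where
  toFun F := ⟨consCoeff j F, consCoeff_memℓp j F⟩
  map_add' F G := by
    ext α
    change consCoeff j (⇑(F + G)) α = consCoeff j F α + consCoeff j G α
    cases α with
    | nil => simp [consCoeff]
    | cons i α => by_cases h : i = j <;> simp [consCoeff, h]
  map_smul' c F := by
    ext α
    change consCoeff j (⇑(c • F)) α = c • consCoeff j F α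
    cases α with
    | nil => simp [consCoeff]
    | cons i α => by_cases h : i = j <;> simp [consCoeff, h]
  norm_map' F := by
    have h := lp.hasSum_norm (p := 2) (by norm_num)
      (⟨consCoeff j F, consCoeff_memℓp j F⟩ : Fock d E)
    simp only [ENNReal.toReal_ofNat, Real.rpow_ofNat] at h
    exact (sq_eq_sq₀ (norm_nonneg _) (norm_nonneg _)).1 (h.unique (consCoeff_hasSum j F))

/-- The left creation operator `L_j ⊗ I_E` on `F²_d ⊗ E`, sending `e_α ⊗ v` to `e_{jα} ⊗ v`. -/
def leftCreation (E : Type*) [NormedAddCommGroup E] [InnerProductSpace ℂ E] (j : Fin d) :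
    Fock d E →L[ℂ] Fock d E := (leftCreationₗᵢ E j).toContinuousLinearMap

theorem leftCreation_apply [InnerProductSpace ℂ E] (j : Fin d) (F : Fock d E) (α : Word d) :
    leftCreation E j F α = consCoeff j F α := rfl

/-- The embedding `v ↦ e_α ⊗ v` of `E` into `F²_d ⊗ E`. -/
def basisEmb (E : Type*) [NormedAddCommGroup E] [InnerProductSpace ℂ E] (α : Word d) :
    E →L[ℂ] Fock d E := lp.singleContinuousLinearMap ℂ (fun _ : Word d => E) 2 α

end Fock

section Series

variable {d : ℕ} {H : Type*} [NormedAddCommGroup H] [InnerProductSpace ℂ H]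

/-- Formal power series `∑ Z^α F_α` in `d` non-commuting variables with coefficients in `L(H)`. -/
abbrev OpSeries (d : ℕ) (H : Type*) [NormedAddCommGroup H] [InnerProductSpace ℂ H] :=
  Word d → (H →L[ℂ] H)

/-- The constant series `I`. -/
def oneSeries (d : ℕ) (H : Type*) [NormedAddCommGroup H] [InnerProductSpace ℂ H] : OpSeries d H :=
  fun α => if α = [] then 1 else 0

/-- Left product `M(Z) F(Z)`: the coefficient at `γ` is `∑_{αβ = γ} M_α F_β`. -/
def leftMulVec (M : OpSeries d H) (F : Word d → H) : Word d → H :=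
  fun γ => ∑ i ∈ Finset.range (γ.length + 1), M (γ.take i) (F (γ.drop i))

/-- Right product `M(Z) •_R F(Z)`: the coefficient at `γ` is `∑_{βα = γ} M_α F_β`. -/
def rightMulVec (M : OpSeries d H) (F : Word d → H) : Word d → H :=
  fun γ => ∑ i ∈ Finset.range (γ.length + 1), M (γ.drop i) (F (γ.take i))

/-- Left product of operator-valued series. -/
def leftMul (M N : OpSeries d H) : OpSeries d H :=
  fun γ => ∑ i ∈ Finset.range (γ.length + 1), M (γ.take i) * N (γ.drop i)

/-- Right product `M •_R N` of operator-valued series. -/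
def rightMul (M N : OpSeries d H) : OpSeries d H :=
  fun γ => ∑ i ∈ Finset.range (γ.length + 1), M (γ.drop i) * N (γ.take i)

/-- The inverse of the series `F` for the left product, when `F_∅` is invertible, computed
recursively from `F⁻¹ F = I`. -/
def leftInv (F : OpSeries d H) (γ : Word d) : H →L[ℂ] H :=
  (oneSeries d H γ - ∑ i : Fin γ.length, leftInv F (γ.take i) * F (γ.drop i)) *
    Ring.inverse (F [])
termination_by γ.length
decreasing_by simp

/-- The inverse of the series `F` for the right product, when `F_∅` is invertible, computed
recursively from `F⁻¹ •_R F = I`. -/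
def rightInv (F : OpSeries d H) (γ : Word d) : H →L[ℂ] H :=
  (oneSeries d H γ - ∑ i : Fin γ.length, rightInv F (γ.drop (i + 1)) * F (γ.take (i + 1))) *
    Ring.inverse (F [])
termination_by γ.length
decreasing_by
  simp only [List.length_drop]
  omega

theorem leftMul_leftInv (F : OpSeries d H) (hF : IsUnit (F [])) :
    leftMul (leftInv F) F = oneSeries d H := by
  funext γ
  rw [leftMul, Finset.sum_range_succ, List.take_length, List.drop_length, leftInv, mul_assoc,
    Ring.inverse_mul_cancel _ hF, mul_one, Finset.sum_range, add_sub_cancel]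

theorem rightMul_rightInv (F : OpSeries d H) (hF : IsUnit (F [])) :
    rightMul (rightInv F) F = oneSeries d H := by
  funext γ
  rw [rightMul, Finset.sum_range_succ', List.drop_zero, List.take_zero, rightInv, mul_assoc,
    Ring.inverse_mul_cancel _ hF, mul_one, Finset.sum_range, add_sub_cancel]

/-- `B` is in the left free Schur class: left multiplication by `B(Z)` is a contraction of
`F²_d ⊗ H`. -/
def IsLeftSchur (B : OpSeries d H) : Prop :=
  ∃ M : Fock d H →L[ℂ] Fock d H, ‖M‖ ≤ 1 ∧ ∀ F : Fock d H, ⇑(M F) = leftMulVec B F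

/-- `B` is in the right free Schur class: right multiplication by `B(Z)` is a contraction of
`F²_d ⊗ H`. -/
def IsRightSchur (B : OpSeries d H) : Prop :=
  ∃ M : Fock d H →L[ℂ] Fock d H, ‖M‖ ≤ 1 ∧ ∀ F : Fock d H, ⇑(M F) = rightMulVec B F

end Series

/-- A transpose-conjugate pair `B = (B^L, B^R)` of free Schur multipliers, with `I - B_∅`
invertible (this is the value at `Z = 0` of the condition that `I - B(Z)` be invertible for all
strict row contractions `Z`). -/
structure SchurPair (d : ℕ) (H : Type*) [NormedAddCommGroup H] [InnerProductSpace ℂ H] where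
  left : OpSeries d H
  right : OpSeries d H
  left_schur : IsLeftSchur left
  right_schur : IsRightSchur right
  transpose : ∀ α, right α = left α.reverse
  isUnit : IsUnit (1 - right [])

namespace SchurPair

variable {d : ℕ} {H : Type*} [NormedAddCommGroup H] [InnerProductSpace ℂ H]

/-- The operator `M^R_B` of right multiplication by `B^R(Z)` on `F²_d ⊗ H`. -/
def mulRight (B : SchurPair d H) : Fock d H →L[ℂ] Fock d H := B.right_schur.choose

theorem norm_mulRight_le (B : SchurPair d H) : ‖B.mulRight‖ ≤ 1 := B.right_schur.choose_spec.1

theorem mulRight_apply (B : SchurPair d H) (F : Fock d H) :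
    ⇑(B.mulRight F) = rightMulVec B.right F := B.right_schur.choose_spec.2 F

/-- The left free Herglotz function `H^L_B = (I - B^L)⁻¹ (I + B^L)`. -/
def herglotzLeft (B : SchurPair d H) : OpSeries d H :=
  leftMul (leftInv (oneSeries d H - B.left)) (oneSeries d H + B.left)

/-- The right free Herglotz function `H^R_B = (I - B^R)⁻¹ •_R (I + B^R)`. -/
def herglotzRight (B : SchurPair d H) : OpSeries d H :=
  rightMul (rightInv (oneSeries d H - B.right)) (oneSeries d H + B.right)

variable [CompleteSpace H]

/-- Coefficients of the right free de Branges–Rovnyak kernel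
`k̂^R(Z,W) = k̂(Z,W) - B(Z) •_R k̂(Z,W) •_R B(W)^*` with `k̂(Z,W) = ∑ Z^α (W^*)^{α^T}`: the entry at
`(α, β)` is `δ_{α,β} I - ∑ B_{α'} B_{β'}^*` over all `γ, α', β'` with `α = γα'`, `β = γβ'`. -/
def dbrKernel (B : SchurPair d H) : Matrix (Word d) (Word d) (H →L[ℂ] H) :=
  fun α β => (if α = β then 1 else 0) -
    ∑ i ∈ Finset.range (α.length + 1), ∑ j ∈ Finset.range (β.length + 1),
      if α.take i = β.take j then B.right (α.drop i) * star (B.right (β.drop j)) else 0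

/-- Coefficients of the right free Herglotz kernel
`K̂^R(Z,W) = ½ (H(Z) •_R k̂(Z,W) + k̂(Z,W) •_R H(W)^*)`, `H = H^R_B`: the entry at `(α, β)` is
`½ (∑_{βγ = α} H_γ + ∑_{αγ = β} H_γ^*)`. -/
def herglotzKernel (B : SchurPair d H) : Matrix (Word d) (Word d) (H →L[ℂ] H) :=
  fun α β => (1 / 2 : ℂ) •
    ((if β <+: α then B.herglotzRight (α.drop β.length) else 0) +
      (if α <+: β then star (B.herglotzRight (β.drop α.length)) else 0))

end SchurPair

section Positivity

variable {d : ℕ} {H : Type*} [NormedAddCommGroup H] [InnerProductSpace ℂ H]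

theorem inner_basisEmb (α : Word d) (h : H) (F : Fock d H) :
    ⟪basisEmb H α h, F⟫_ℂ = ⟪h, F α⟫_ℂ := by
  exact lp.inner_single_left (𝕜 := ℂ) (G := fun _ : Word d => H) α h F

theorem rightMul_add (F G K : OpSeries d H) :
    rightMul F (G + K) = rightMul F G + rightMul F K := by
  funext γ
  simp [rightMul, mul_add, Finset.sum_add_distrib]

theorem rightMul_sub (F G K : OpSeries d H) :
    rightMul F (G - K) = rightMul F G - rightMul F K := by
  funext γ
  simp [rightMul, mul_sub, Finset.sum_sub_distrib]

theorem rightMul_one (F : OpSeries d H) : rightMul F (oneSeries d H) = F := by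
  funext γ
  rw [rightMul, Finset.sum_range_succ', Finset.sum_eq_zero]
  · simp [oneSeries]
  · intro i hi
    rw [Finset.mem_range] at hi
    have : γ.take (i + 1) ≠ [] := by
      intro h
      have := congrArg List.length h
      rw [List.length_take, List.length_nil] at this
      omega
    simp [oneSeries, this]

variable [CompleteSpace H]

theorem posSemidef_of_contraction {X E : Type*} [NormedAddCommGroup E] [InnerProductSpace ℂ E]
    (K : Matrix X X (H →L[ℂ] H)) (V : X → H →L[ℂ] E) (T : E →L[ℂ] E) (hT : ‖T‖ ≤ 1)
    (hK : ∀ x y g h, ⟪g, K x y h⟫_ℂ = ⟪V x g, V y h⟫_ℂ - ⟪T (V x g), T (V y h)⟫_ℂ) :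
    K.PosSemidef := by
  have tfae : K.PosSemidef ↔ K.IsHermitian ∧ ∀ vv : X →₀ H,
      0 ≤ RCLike.re (vv.sum fun x w => vv.sum fun x' w' => ⟪K x' x w, w'⟫_ℂ) :=
    (RKHS.posSemidef_tfae (K := K)).out 0 2
  refine tfae.2 ⟨?_, fun vv => ?_⟩
  · ext x y h
    refine ext_inner_left ℂ fun g => ?_
    rw [Matrix.conjTranspose_apply, ContinuousLinearMap.star_eq_adjoint,
      ContinuousLinearMap.adjoint_inner_right, ← inner_conj_symm, hK, hK, map_sub,
      inner_conj_symm, inner_conj_symm]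
  · have h1 : (vv.sum fun x w => vv.sum fun x' w' => ⟪K x' x w, w'⟫_ℂ) =
        ⟪vv.sum fun x w => V x w, vv.sum fun x w => V x w⟫_ℂ -
          ⟪T (vv.sum fun x w => V x w), T (vv.sum fun x w => V x w)⟫_ℂ := by
      simp only [Finsupp.sum, map_sum, sum_inner, inner_sum, ← Finset.sum_sub_distrib]
      rw [Finset.sum_comm]
      refine Finset.sum_congr rfl fun x _ => Finset.sum_congr rfl fun y _ => ?_
      rw [← inner_conj_symm, hK, map_sub, inner_conj_symm, inner_conj_symm]
    rw [h1, map_sub, inner_self_eq_norm_sq, inner_self_eq_norm_sq, sub_nonneg]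
    refine pow_le_pow_left₀ (norm_nonneg _) ?_ 2
    exact (T.le_opNorm _).trans (by nlinarith [norm_nonneg (vv.sum fun x w => V x w)])

/-- `h ↦ ∑_{γη = β} e_γ ⊗ F_η^* h`. -/
def rowEmb (F : OpSeries d H) (β : Word d) : H →L[ℂ] Fock d H :=
  ∑ i ∈ Finset.range (β.length + 1), basisEmb H (β.take i) ∘L star (F (β.drop i))

theorem inner_rowEmb_left (F : OpSeries d H) (β : Word d) (h : H) (G : Fock d H) :
    ⟪rowEmb F β h, G⟫_ℂ = ⟪h, rightMulVec F G β⟫_ℂ := by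
  simp only [rowEmb, _root_.sum_apply, sum_inner, rightMulVec, inner_sum,
    ContinuousLinearMap.comp_apply, inner_basisEmb, ContinuousLinearMap.star_eq_adjoint,
    ContinuousLinearMap.adjoint_inner_left]

theorem inner_rowEmb_rowEmb (F G : OpSeries d H) (α β : Word d) (g h : H) :
    ⟪rowEmb F α g, rowEmb G β h⟫_ℂ =
      ⟪g, (∑ i ∈ Finset.range (α.length + 1), ∑ j ∈ Finset.range (β.length + 1),
        if α.take i = β.take j then F (α.drop i) * star (G (β.drop j)) else 0) h⟫_ℂ := by
  simp only [rowEmb, _root_.sum_apply, sum_inner, inner_sum,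
    ContinuousLinearMap.comp_apply, inner_basisEmb]
  rw [Finset.sum_comm]
  refine Finset.sum_congr rfl fun i _ => Finset.sum_congr rfl fun j _ => ?_
  have : (basisEmb H (β.take j) ((star (G (β.drop j))) h)) (α.take i) =
      if α.take i = β.take j then (star (G (β.drop j))) h else 0 := by
    change (Pi.single (β.take j) ((star (G (β.drop j))) h) : Word d → H) (α.take i) = _
    rw [Pi.single_apply]
  rw [this]
  split_ifs
  · rw [ContinuousLinearMap.star_eq_adjoint (F _), ContinuousLinearMap.adjoint_inner_left]
    rfl
  · simp

theorem adjoint_mulRight_basisEmb (B : SchurPair d H) (β : Word d) (h : H) :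
    B.mulRight.adjoint (basisEmb H β h) = rowEmb B.right β h := by
  refine ext_inner_right ℂ fun F => ?_
  rw [ContinuousLinearMap.adjoint_inner_left, inner_basisEmb, inner_rowEmb_left, B.mulRight_apply]

theorem adjoint_mulRight_rowEmb (B : SchurPair d H) (G : OpSeries d H) (β : Word d) (h : H) :
    B.mulRight.adjoint (rowEmb G β h) = rowEmb (rightMul G B.right) β h := by
  have key : ∀ (n : ℕ) (f : ℕ → ℕ → Fock d H),
      ∑ i ∈ Finset.range (n + 1), ∑ l ∈ Finset.range (i + 1), f l i =
        ∑ l ∈ Finset.range (n + 1), ∑ m ∈ Finset.range (n - l + 1), f l (l + m) := by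
    intro n f
    rw [Finset.sum_sigma', Finset.sum_sigma']
    refine Finset.sum_bij' (fun p _ => ⟨p.2, p.1 - p.2⟩) (fun p _ => ⟨p.1 + p.2, p.1⟩) ?_ ?_ ?_ ?_ ?_
    · rintro ⟨i, l⟩ h; simp only [Finset.mem_sigma, Finset.mem_range] at h ⊢; omega
    · rintro ⟨i, l⟩ h; simp only [Finset.mem_sigma, Finset.mem_range] at h ⊢; omega
    · rintro ⟨i, l⟩ h
      simp only [Finset.mem_sigma, Finset.mem_range] at h
      simp only [Sigma.mk.injEq, heq_eq_eq, and_true]; omega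
    · rintro ⟨i, l⟩ h; simp
    · rintro ⟨i, l⟩ h
      simp only [Finset.mem_sigma, Finset.mem_range] at h
      simp only []
      congr 1; omega
  simp only [rowEmb, _root_.sum_apply, map_sum, ContinuousLinearMap.comp_apply,
    adjoint_mulRight_basisEmb]
  trans ∑ i ∈ Finset.range (β.length + 1), ∑ l ∈ Finset.range (i + 1),
      basisEmb H (β.take l) (star (B.right ((β.take i).drop l)) (star (G (β.drop i)) h))
  · refine Finset.sum_congr rfl fun i hi => ?_
    rw [Finset.mem_range] at hi
    have hl : (β.take i).length = i := by rw [List.length_take]; omega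
    rw [hl]
    refine Finset.sum_congr rfl fun l hl => ?_
    rw [Finset.mem_range] at hl
    rw [List.take_take, min_eq_left (by omega)]
  · rw [key]
    refine Finset.sum_congr rfl fun l hl => ?_
    rw [rightMul, star_sum, _root_.sum_apply, map_sum, List.length_drop]
    refine Finset.sum_congr rfl fun m hm => ?_
    rw [star_mul, List.drop_drop, List.take_drop]
    rfl

theorem rowEmb_oneSeries (β : Word d) : rowEmb (oneSeries d H) β = basisEmb H β := by
  rw [rowEmb, Finset.sum_range_succ, List.take_length, List.drop_length,
    Finset.sum_eq_zero, zero_add]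
  · simp only [oneSeries, if_true, star_one]
    rfl
  · intro i hi
    rw [Finset.mem_range] at hi
    have : β.drop i ≠ [] := by simpa using hi
    simp only [oneSeries, if_neg this, star_zero, ContinuousLinearMap.comp_zero]

theorem prefix_sum {R : Type*} [AddCommMonoid R] (α β : Word d) (f : Word d → R) :
    (∑ i ∈ Finset.range (α.length + 1), ∑ j ∈ Finset.range (β.length + 1),
      if α.take i = β.take j then (if β.drop j = [] then f (α.drop i) else 0) else 0) =
      if β <+: α then f (α.drop β.length) else 0 := by
  have h1 : ∀ i ∈ Finset.range (α.length + 1), (∑ j ∈ Finset.range (β.length + 1),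
      if α.take i = β.take j then (if β.drop j = [] then f (α.drop i) else 0) else 0) =
      if α.take i = β then f (α.drop i) else 0 := by
    intro i _
    rw [Finset.sum_range_succ, List.take_length, List.drop_length, Finset.sum_eq_zero]
    · simp
    · intro j hj
      rw [Finset.mem_range] at hj
      have : β.drop j ≠ [] := by simpa using hj
      simp [this]
  rw [Finset.sum_congr rfl h1]
  split_ifs with hp
  · obtain ⟨γ, rfl⟩ := hp
    rw [Finset.sum_eq_single β.length]
    · simp
    · intro i hi hne
      rw [Finset.mem_range] at hi
      rw [if_neg]
      intro h
      have := congrArg List.length h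
      rw [List.length_take] at this
      omega
    · intro h
      exact absurd (Finset.mem_range.2 (by simp)) h
  · refine Finset.sum_eq_zero fun i _ => if_neg ?_
    rintro h
    exact hp (h ▸ List.take_prefix i α)

namespace SchurPair

instance dbrKernel_posSemidef (B : SchurPair d H) : Fact B.dbrKernel.PosSemidef := by
  refine ⟨posSemidef_of_contraction _ (basisEmb H) B.mulRight.adjoint ?_ fun α β g h => ?_⟩
  · rw [LinearIsometryEquiv.norm_map]
    exact B.norm_mulRight_le
  · rw [adjoint_mulRight_basisEmb, adjoint_mulRight_basisEmb, inner_rowEmb_rowEmb, dbrKernel,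
      sub_apply, inner_sub_right, inner_basisEmb]
    congr 1
    change _ = ⟪g, (Pi.single β h : Word d → H) α⟫_ℂ
    rw [Pi.single_apply]
    split_ifs <;> simp

instance herglotzKernel_posSemidef (B : SchurPair d H) : Fact B.herglotzKernel.PosSemidef := by
  have hu : IsUnit ((oneSeries d H - B.right) []) := by
    simpa [oneSeries] using B.isUnit
  set G := rightInv (oneSeries d H - B.right) with hG
  have hinv : rightMul G (oneSeries d H - B.right) = oneSeries d H := rightMul_rightInv _ hu
  rw [rightMul_sub, rightMul_one] at hinv
  have hH : B.herglotzRight = G + rightMul G B.right := by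
    rw [herglotzRight, ← hG, rightMul_add, rightMul_one]
  have hGB : rightMul G B.right = G - oneSeries d H := by rw [← hinv]; abel
  rw [hGB] at hH
  refine ⟨posSemidef_of_contraction _ (rowEmb G) B.mulRight.adjoint ?_ fun α β g h => ?_⟩
  · rw [LinearIsometryEquiv.norm_map]
    exact B.norm_mulRight_le
  · rw [adjoint_mulRight_rowEmb, adjoint_mulRight_rowEmb, inner_rowEmb_rowEmb,
      inner_rowEmb_rowEmb, ← inner_sub_right, ← sub_apply]
    congr 2
    have e1 := prefix_sum α β (fun γ => B.herglotzRight γ)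
    have e2 := prefix_sum β α (fun γ => star (B.herglotzRight γ))
    rw [herglotzKernel, ← e1, ← e2, Finset.sum_comm (s := Finset.range (β.length + 1)),
      ← Finset.sum_add_distrib, Finset.smul_sum, ← Finset.sum_sub_distrib]
    refine Finset.sum_congr rfl fun i _ => ?_
    rw [← Finset.sum_add_distrib, Finset.smul_sum, ← Finset.sum_sub_distrib]
    refine Finset.sum_congr rfl fun j _ => ?_
    by_cases hij : α.take i = β.take j
    · rw [if_pos hij, if_pos hij.symm, if_pos hij, if_pos hij, hGB, hH]
      simp only [Pi.add_apply, Pi.sub_apply, oneSeries]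
      set a := G (α.drop i)
      set b := G (β.drop j)
      rw [one_div, inv_smul_eq_iff₀ two_ne_zero, two_smul]
      split_ifs <;> simp <;> noncomm_ring
    · rw [if_neg hij, if_neg (Ne.symm hij), if_neg hij, if_neg hij]
      simp

end SchurPair

end Positivity

section DiskAlgebra

variable {d : ℕ}

/-- Polynomials in the left creation operators on `F²_d`. -/
def polyAlgebra (d : ℕ) : Subalgebra ℂ (Fock d ℂ →L[ℂ] Fock d ℂ) :=
  Algebra.adjoin ℂ (Set.range fun j : Fin d => leftCreation ℂ j)

/-- The left free disk algebra `𝒜_d`: the norm-closed unital algebra generated by the left creation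
operators on `F²_d`. -/
def diskAlgebra (d : ℕ) : Subalgebra ℂ (Fock d ℂ →L[ℂ] Fock d ℂ) :=
  (polyAlgebra d).topologicalClosure

/-- The free disk operator system: the norm closure of `𝒜_d + 𝒜_d^*`. -/
def diskSystem (d : ℕ) : Submodule ℂ (Fock d ℂ →L[ℂ] Fock d ℂ) :=
  (Subalgebra.toSubmodule (diskAlgebra d) ⊔
    Subalgebra.toSubmodule (star (diskAlgebra d))).topologicalClosure

theorem polyAlgebra_le : polyAlgebra d ≤ diskAlgebra d := Subalgebra.le_topologicalClosure _

theorem leftCreation_mem (j : Fin d) : leftCreation ℂ j ∈ diskAlgebra d :=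
  polyAlgebra_le (Algebra.subset_adjoin ⟨j, rfl⟩)

theorem diskAlgebra_mem_system {a : Fock d ℂ →L[ℂ] Fock d ℂ} (ha : a ∈ diskAlgebra d) :
    a ∈ diskSystem d :=
  Submodule.le_topologicalClosure _ (Submodule.mem_sup_left ha)

theorem star_mem_system {a : Fock d ℂ →L[ℂ] Fock d ℂ} (ha : a ∈ diskAlgebra d) :
    star a ∈ diskSystem d :=
  Submodule.le_topologicalClosure _ (Submodule.mem_sup_right (by
    change star a ∈ star (diskAlgebra d)
    simpa using ha))

theorem star_leftCreation_mul (i j : Fin d) :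
    star (leftCreation ℂ i) * leftCreation ℂ j = if i = j then 1 else 0 := by
  ext1 F
  refine ext_inner_left ℂ fun G => ?_
  rw [ContinuousLinearMap.star_eq_adjoint]
  change ⟪G, (leftCreation ℂ i).adjoint (leftCreation ℂ j F)⟫_ℂ = _
  rw [ContinuousLinearMap.adjoint_inner_right]
  split_ifs with h
  · subst h
    exact (leftCreationₗᵢ ℂ i).inner_map_map G F
  · rw [lp.inner_eq_tsum]
    have : ∀ α, ⟪leftCreation ℂ i G α, leftCreation ℂ j F α⟫_ℂ = 0 := by
      intro α
      rw [leftCreation_apply, leftCreation_apply]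
      cases α with
      | nil => simp [consCoeff]
      | cons k α =>
        by_cases hk : k = i
        · subst hk; simp [consCoeff, h]
        · simp [consCoeff, hk]
    rw [tsum_congr this, tsum_zero]
    simp

theorem monomial_mem {x : Fock d ℂ →L[ℂ] Fock d ℂ}
    (hx : x ∈ Submonoid.closure (Set.range fun j : Fin d => leftCreation ℂ j)) :
    x ∈ diskAlgebra d :=
  polyAlgebra_le ((Submonoid.closure_le (S := (polyAlgebra d).toSubmonoid)).2
    Algebra.subset_adjoin hx)

theorem star_list_prod_mul_mem (l m : List (Fin d)) :
    star (l.map fun j => leftCreation ℂ j).prod * (m.map fun j => leftCreation ℂ j).prod ∈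
      diskSystem d := by
  have hmem : ∀ l : List (Fin d), (l.map fun j => leftCreation ℂ j).prod ∈ diskAlgebra d := by
    intro l
    refine list_prod_mem fun x hx => ?_
    obtain ⟨j, _, rfl⟩ := List.mem_map.1 hx
    exact leftCreation_mem j
  induction l generalizing m with
  | nil =>
    rw [List.map_nil, List.prod_nil, star_one, one_mul]
    exact diskAlgebra_mem_system (hmem m)
  | cons i l ih =>
    cases m with
    | nil =>
      rw [List.map_nil, List.prod_nil, mul_one]
      exact star_mem_system (hmem _)
    | cons j m =>
      rw [List.map_cons, List.map_cons, List.prod_cons, List.prod_cons, star_mul, mul_assoc,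
        ← mul_assoc (star (leftCreation ℂ i)), star_leftCreation_mul]
      split_ifs
      · rw [one_mul]
        exact ih m
      · rw [zero_mul, mul_zero]
        exact zero_mem _

theorem star_monomial_mul_mem {x y : Fock d ℂ →L[ℂ] Fock d ℂ}
    (hx : x ∈ Submonoid.closure (Set.range fun j : Fin d => leftCreation ℂ j))
    (hy : y ∈ Submonoid.closure (Set.range fun j : Fin d => leftCreation ℂ j)) :
    star x * y ∈ diskSystem d := by
  have key : ∀ z ∈ Submonoid.closure (Set.range fun j : Fin d => leftCreation ℂ j),
      ∃ l : List (Fin d), (l.map fun j => leftCreation ℂ j).prod = z := by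
    intro z hz
    induction hz using Submonoid.closure_induction with
    | mem z hz => obtain ⟨j, rfl⟩ := hz; exact ⟨[j], by simp⟩
    | one => exact ⟨[], by simp⟩
    | mul u v _ _ hu hv =>
      obtain ⟨l, rfl⟩ := hu
      obtain ⟨m, rfl⟩ := hv
      exact ⟨l ++ m, by rw [List.map_append, List.prod_append]⟩
  obtain ⟨l, rfl⟩ := key x hx
  obtain ⟨m, rfl⟩ := key y hy
  exact star_list_prod_mul_mem l m

theorem star_poly_mul_mem {x y : Fock d ℂ →L[ℂ] Fock d ℂ}
    (hx : x ∈ polyAlgebra d) (hy : y ∈ polyAlgebra d) : star x * y ∈ diskSystem d := by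
  have hspan : Subalgebra.toSubmodule (polyAlgebra d) = Submodule.span ℂ
      (Submonoid.closure (Set.range fun j : Fin d => leftCreation ℂ j) :
        Set (Fock d ℂ →L[ℂ] Fock d ℂ)) := Algebra.adjoin_eq_span _ _
  rw [← Subalgebra.mem_toSubmodule, hspan] at hx hy
  have h1 : ∀ u ∈ Submonoid.closure (Set.range fun j : Fin d => leftCreation ℂ j),
      star u * y ∈ diskSystem d := by
    intro u hu
    refine Submodule.span_induction (p := fun y _ => star u * y ∈ diskSystem d)
      (fun v hv => star_monomial_mul_mem hu hv) ?_ ?_ ?_ hy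
    · rw [mul_zero]; exact zero_mem _
    · intro p q _ _ hp hq; rw [mul_add]; exact add_mem hp hq
    · intro c p _ hp; rw [mul_smul_comm]; exact Submodule.smul_mem _ _ hp
  refine Submodule.span_induction (p := fun x _ => star x * y ∈ diskSystem d)
    (fun u hu => h1 u hu) ?_ ?_ ?_ hx
  · rw [star_zero, zero_mul]; exact zero_mem _
  · intro p q _ _ hp hq; rw [star_add, add_mul]; exact add_mem hp hq
  · intro c p _ hp; rw [star_smul, smul_mul_assoc]; exact Submodule.smul_mem _ _ hp

/-- The semi-Dirichlet property: `𝒜_d^* 𝒜_d` lies in the closure of `𝒜_d + 𝒜_d^*`. -/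
theorem semiDirichlet {a b : Fock d ℂ →L[ℂ] Fock d ℂ} (ha : a ∈ diskAlgebra d)
    (hb : b ∈ diskAlgebra d) : star a * b ∈ diskSystem d := by
  have hcl : IsClosed (diskSystem d : Set (Fock d ℂ →L[ℂ] Fock d ℂ)) :=
    Submodule.isClosed_topologicalClosure _
  have hcont : Continuous
      fun p : (Fock d ℂ →L[ℂ] Fock d ℂ) × (Fock d ℂ →L[ℂ] Fock d ℂ) => star p.1 * p.2 := by
    fun_prop
  have ha' : a ∈ closure (polyAlgebra d : Set (Fock d ℂ →L[ℂ] Fock d ℂ)) := by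
    rw [← Subalgebra.topologicalClosure_coe]; exact ha
  have hb' : b ∈ closure (polyAlgebra d : Set (Fock d ℂ →L[ℂ] Fock d ℂ)) := by
    rw [← Subalgebra.topologicalClosure_coe]; exact hb
  rw [← SetLike.mem_coe, ← hcl.closure_eq]
  exact map_mem_closure₂ (f := fun x y => star x * y) hcont ha' hb' fun x hx y hy => star_poly_mul_mem hx hy

end DiskAlgebra

/-- Completely positive maps from the free disk operator system into `L(H)`: linear maps whose
matrix amplifications send positive operator matrices to positive operator matrices. -/
structure FreeCPMap (d : ℕ) (H : Type*) [NormedAddCommGroup H] [InnerProductSpace ℂ H] where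
  toLinearMap : diskSystem d →ₗ[ℂ] (H →L[ℂ] H)
  completelyPositive : ∀ (n : ℕ) (x : Fin n → Fin n → diskSystem d),
    (∀ v : Fin n → Fock d ℂ, 0 ≤ ∑ i, ∑ j, ⟪v i, (x i j : Fock d ℂ →L[ℂ] Fock d ℂ) (v j)⟫_ℂ) →
    ∀ h : Fin n → H, 0 ≤ ∑ i, ∑ j, ⟪h i, toLinearMap (x i j) (h j)⟫_ℂ

section GNS

variable {d : ℕ} {H : Type*} [NormedAddCommGroup H] [InnerProductSpace ℂ H]

namespace FreeCPMap

/-- The element `a^* b` of the free disk operator system, for `a, b` in the disk algebra. -/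
def starMul (a b : diskAlgebra d) : diskSystem d := ⟨star a.1 * b.1, semiDirichlet a.2 b.2⟩

theorem starMul_add_right (a b c : diskAlgebra d) :
    starMul a (b + c) = starMul a b + starMul a c :=
  Subtype.ext (mul_add (star a.1) b.1 c.1)

theorem starMul_add_left (a b c : diskAlgebra d) :
    starMul (a + b) c = starMul a c + starMul b c :=
  Subtype.ext (by
    change star (a.1 + b.1) * c.1 = star a.1 * c.1 + star b.1 * c.1
    rw [star_add, add_mul])

theorem starMul_smul_right (c : ℂ) (a b : diskAlgebra d) :
    starMul a (c • b) = c • starMul a b :=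
  Subtype.ext (mul_smul_comm c (star a.1) b.1)

theorem starMul_smul_left (c : ℂ) (a b : diskAlgebra d) :
    starMul (c • a) b = conj c • starMul a b :=
  Subtype.ext (by
    change star (c • a.1) * b.1 = conj c • (star a.1 * b.1)
    rw [star_smul, smul_mul_assoc]; rfl)

/-- The sesquilinear form on `𝒜_d ⊗ H` with `⟨a ⊗ h, b ⊗ g⟩ = ⟨h, μ(a^* b) g⟩`. -/
def gnsForm (μ : FreeCPMap d H) :
    (diskAlgebra d ⊗[ℂ] H) →ₗ⋆[ℂ] (diskAlgebra d ⊗[ℂ] H) →ₗ[ℂ] ℂ :=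
  TensorProduct.lift <| LinearMap.mk₂'ₛₗ (starRingEnd ℂ) (starRingEnd ℂ)
    (fun a h => TensorProduct.lift <| LinearMap.mk₂ ℂ
      (fun b g => ⟪h, μ.toLinearMap (starMul a b) g⟫_ℂ)
      (fun b c g => by rw [starMul_add_right, map_add, add_apply, inner_add_right])
      (fun c b g => by
        rw [starMul_smul_right, map_smul, smul_apply, inner_smul_right, smul_eq_mul])
      (fun b g k => by rw [map_add, inner_add_right])
      (fun c b g => by rw [map_smul, inner_smul_right, smul_eq_mul]))
    (fun a b h => TensorProduct.ext' fun c g => by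
      simp only [TensorProduct.lift.tmul, LinearMap.mk₂_apply, LinearMap.add_apply]
      rw [starMul_add_left, map_add, add_apply, inner_add_right])
    (fun c a h => TensorProduct.ext' fun b g => by
      simp only [TensorProduct.lift.tmul, LinearMap.mk₂_apply, LinearMap.smul_apply]
      rw [starMul_smul_left, map_smul, smul_apply, inner_smul_right, smul_eq_mul])
    (fun a h k => TensorProduct.ext' fun b g => by
      simp only [TensorProduct.lift.tmul, LinearMap.mk₂_apply, LinearMap.add_apply]
      rw [inner_add_left])
    (fun c a h => TensorProduct.ext' fun b g => by
      simp only [TensorProduct.lift.tmul, LinearMap.mk₂_apply, LinearMap.smul_apply]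
      rw [inner_smul_left, smul_eq_mul])

theorem gnsForm_tmul (μ : FreeCPMap d H) (a b : diskAlgebra d) (h g : H) :
    μ.gnsForm (a ⊗ₜ h) (b ⊗ₜ g) = ⟪h, μ.toLinearMap (starMul a b) g⟫_ℂ := rfl

theorem sum_inner_starMul {n : ℕ} (a : Fin n → diskAlgebra d) (v : Fin n → Fock d ℂ) :
    ∑ i, ∑ j, ⟪v i, (starMul (a i) (a j)).1 (v j)⟫_ℂ =
      ⟪∑ i, (a i).1 (v i), ∑ i, (a i).1 (v i)⟫_ℂ := by
  simp only [sum_inner, inner_sum]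
  rw [Finset.sum_comm]
  refine Finset.sum_congr rfl fun i _ => Finset.sum_congr rfl fun j _ => ?_
  change ⟪v j, (star (a j).1) ((a i).1 (v i))⟫_ℂ = _
  rw [ContinuousLinearMap.star_eq_adjoint, ContinuousLinearMap.adjoint_inner_right]

theorem gnsForm_sum (μ : FreeCPMap d H) {n : ℕ} (a : Fin n → diskAlgebra d) (h : Fin n → H) :
    μ.gnsForm (∑ i, a i ⊗ₜ h i) (∑ i, a i ⊗ₜ h i) =
      ∑ i, ∑ j, ⟪h i, μ.toLinearMap (starMul (a i) (a j)) (h j)⟫_ℂ := by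
  simp only [map_sum, LinearMap.sum_apply, gnsForm_tmul]
  exact Finset.sum_comm

theorem gnsForm_self_nonneg (μ : FreeCPMap d H) (x : diskAlgebra d ⊗[ℂ] H) :
    0 ≤ μ.gnsForm x x := by
  obtain ⟨n, a, h, rfl⟩ := TensorProduct.exists_sum_tmul_eq x
  rw [gnsForm_sum]
  refine μ.completelyPositive n (fun i j => starMul (a i) (a j)) (fun v => ?_) h
  rw [sum_inner_starMul]
  exact Complex.nonneg_iff.2 ⟨inner_self_nonneg (𝕜 := ℂ), (inner_self_im (𝕜 := ℂ) _).symm⟩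

theorem gnsForm_conj (μ : FreeCPMap d H) (x y : diskAlgebra d ⊗[ℂ] H) :
    conj (μ.gnsForm y x) = μ.gnsForm x y := by
  have im0 : ∀ z, (μ.gnsForm z z).im = 0 := fun z =>
    ((Complex.nonneg_iff.1 (μ.gnsForm_self_nonneg z)).2).symm
  have h1 := im0 (x + y)
  have h2 := im0 (x + Complex.I • y)
  have hx := im0 x
  have hy := im0 y
  simp only [map_add, LinearMap.add_apply, map_smul, LinearMap.map_smulₛₗ, LinearMap.smul_apply,
    smul_eq_mul, Complex.conj_I] at h1 h2
  simp only [Complex.add_im, Complex.mul_im, Complex.I_re, Complex.I_im, Complex.add_re,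
    Complex.neg_im, Complex.neg_re, Complex.mul_re] at h1 h2
  apply Complex.ext
  · rw [Complex.conj_re]; linarith
  · rw [Complex.conj_im]; linarith

/-- The algebraic tensor product `𝒜_d ⊗ H`, to be equipped with the semi-inner product of `μ`. -/
def GNSPre (_μ : FreeCPMap d H) : Type _ := diskAlgebra d ⊗[ℂ] H

instance (μ : FreeCPMap d H) : AddCommGroup μ.GNSPre :=
  inferInstanceAs (AddCommGroup (diskAlgebra d ⊗[ℂ] H))

instance (μ : FreeCPMap d H) : Module ℂ μ.GNSPre :=
  inferInstanceAs (Module ℂ (diskAlgebra d ⊗[ℂ] H))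

instance (μ : FreeCPMap d H) : PreInnerProductSpace.Core ℂ μ.GNSPre where
  inner x y := μ.gnsForm x y
  conj_inner_symm x y := μ.gnsForm_conj x y
  re_inner_nonneg x := (Complex.nonneg_iff.1 (μ.gnsForm_self_nonneg x)).1
  add_left x y z := by
    exact LinearMap.congr_fun (μ.gnsForm.map_add x y) z
  smul_left x y c := by
    exact LinearMap.congr_fun (μ.gnsForm.map_smulₛₗ c x) y

instance (μ : FreeCPMap d H) : SeminormedAddCommGroup μ.GNSPre :=
  InnerProductSpace.Core.toSeminormedAddCommGroup (𝕜 := ℂ)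

instance (μ : FreeCPMap d H) : InnerProductSpace ℂ μ.GNSPre := .ofCore _

/-- The free Hardy space `F²(μ)`: the Hilbert space completion of `𝒜_d ⊗ H` modulo the null vectors
of `⟨a ⊗ h, b ⊗ g⟩ = ⟨h, μ(a^* b) g⟩`. -/
abbrev FreeHardy (μ : FreeCPMap d H) : Type _ := UniformSpace.Completion μ.GNSPre

/-- The class of `a ⊗ h` in `F²(μ)`. -/
def toHardy (μ : FreeCPMap d H) (a : diskAlgebra d) (h : H) : μ.FreeHardy :=
  ((show μ.GNSPre from a ⊗ₜ[ℂ] h : μ.GNSPre) : μ.FreeHardy)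

theorem inner_toHardy (μ : FreeCPMap d H) (a b : diskAlgebra d) (h g : H) :
    ⟪μ.toHardy a h, μ.toHardy b g⟫_ℂ = ⟪h, μ.toLinearMap (starMul a b) g⟫_ℂ := by
  rw [toHardy, toHardy, UniformSpace.Completion.inner_coe]
  rfl

/-- Left multiplication by `a` on `𝒜_d ⊗ H`. -/
def gnsMul (μ : FreeCPMap d H) (a : diskAlgebra d) : μ.GNSPre →ₗ[ℂ] μ.GNSPre :=
  (LinearMap.mulLeft ℂ a).rTensor H

theorem gnsForm_mul_le (μ : FreeCPMap d H) (a : diskAlgebra d) (x : diskAlgebra d ⊗[ℂ] H) :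
    (μ.gnsForm ((LinearMap.mulLeft ℂ a).rTensor H x) ((LinearMap.mulLeft ℂ a).rTensor H x)).re ≤
      ‖a.1‖ ^ 2 * (μ.gnsForm x x).re := by
  obtain ⟨n, b, h, rfl⟩ := TensorProduct.exists_sum_tmul_eq x
  simp only [map_sum (LinearMap.rTensor H _), LinearMap.rTensor_tmul, LinearMap.mulLeft_apply]
  rw [gnsForm_sum, gnsForm_sum]
  have key := μ.completelyPositive n
    (fun i j => ((‖a.1‖ ^ 2 : ℝ) : ℂ) • starMul (b i) (b j) - starMul (a * b i) (a * b j))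
    (fun v => ?_) h
  · simp only [map_sub, map_smul, sub_apply, smul_apply, inner_sub_right, inner_smul_right,
      Finset.sum_sub_distrib, ← Finset.mul_sum] at key
    have := (Complex.nonneg_iff.1 key).1
    rw [Complex.sub_re, Complex.re_ofReal_mul] at this
    linarith
  · have e1 : ∀ i j, ((((‖a.1‖ ^ 2 : ℝ) : ℂ) • starMul (b i) (b j) -
        starMul (a * b i) (a * b j) : diskSystem d) : Fock d ℂ →L[ℂ] Fock d ℂ) (v j) =
        ((‖a.1‖ ^ 2 : ℝ) : ℂ) • (starMul (b i) (b j)).1 (v j) -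
          (starMul (a * b i) (a * b j)).1 (v j) := fun i j => rfl
    simp only [e1, inner_sub_right, inner_smul_right, Finset.sum_sub_distrib, ← Finset.mul_sum]
    rw [sum_inner_starMul, sum_inner_starMul (fun i => a * b i)]
    have e2 : ∑ i, (a * b i).1 (v i) = a.1 (∑ i, (b i).1 (v i)) := by
      rw [map_sum]; rfl
    rw [e2, inner_self_eq_norm_sq_to_K, inner_self_eq_norm_sq_to_K]
    have := a.1.le_opNorm (∑ i, (b i).1 (v i))
    have h3 : 0 ≤ ‖a.1‖ ^ 2 * ‖∑ i, (b i).1 (v i)‖ ^ 2 - ‖a.1 (∑ i, (b i).1 (v i))‖ ^ 2 := by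
      rw [sub_nonneg, ← mul_pow]
      exact pow_le_pow_left₀ (norm_nonneg _) this 2
    have h4 := Complex.zero_le_real.2 h3
    push_cast at h4 ⊢
    exact h4

theorem norm_gnsMul_le (μ : FreeCPMap d H) (a : diskAlgebra d) (x : μ.GNSPre) :
    ‖μ.gnsMul a x‖ ≤ ‖a.1‖ * ‖x‖ := by
  refine le_of_sq_le_sq ?_ (mul_nonneg (norm_nonneg _) (norm_nonneg _))
  rw [mul_pow, ← inner_self_eq_norm_sq (𝕜 := ℂ) (μ.gnsMul a x),
    ← inner_self_eq_norm_sq (𝕜 := ℂ) x]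
  exact μ.gnsForm_mul_le a x

/-- The Stinespring–GNS representation: `π_μ(a)` is the bounded operator on `F²(μ)` determined by
`π_μ(a) (b ⊗ h) = ab ⊗ h`. -/
def gnsRep (μ : FreeCPMap d H) (a : diskAlgebra d) : μ.FreeHardy →L[ℂ] μ.FreeHardy :=
  ((μ.gnsMul a).mkContinuous ‖a.1‖ (μ.norm_gnsMul_le a)).completion

theorem gnsRep_toHardy (μ : FreeCPMap d H) (a b : diskAlgebra d) (h : H) :
    μ.gnsRep a (μ.toHardy b h) = μ.toHardy (a * b) h := by
  rw [toHardy, gnsRep, ContinuousLinearMap.completion_apply_coe]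
  rfl

end FreeCPMap

end GNS

section Clark

variable {d : ℕ} {H : Type*} [NormedAddCommGroup H] [InnerProductSpace ℂ H]

/-- The operator `L^α` as an element of the free disk algebra. -/
def shiftWord (α : Word d) : diskAlgebra d :=
  (α.map fun j => (⟨leftCreation ℂ j, leftCreation_mem j⟩ : diskAlgebra d)).prod

/-- An element of the free disk algebra, regarded in the free disk operator system. -/
def toSystem (a : diskAlgebra d) : diskSystem d := ⟨a.1, diskAlgebra_mem_system a.2⟩

/-- The row operator `π_μ(L) = (π_μ(L_1), …, π_μ(L_d)) : F²(μ) ⊗ ℂ^d → F²(μ)`. -/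
def rowShift (μ : FreeCPMap d H) :
    PiLp 2 (fun _ : Fin d => μ.FreeHardy) →L[ℂ] μ.FreeHardy :=
  ∑ j : Fin d, μ.gnsRep (shiftWord [j]) ∘L PiLp.proj 2 (fun _ : Fin d => μ.FreeHardy) j

variable [CompleteSpace H]

/-- `μ` is the Aleksandrov–Clark map of `B`: with `H = H^L_B`, one has `μ(I) = Re H_∅` and
`μ(L^{α^T})^* = ½ H_α` for `α ≠ ∅`. -/
def IsAleksandrovClark (B : SchurPair d H) (μ : FreeCPMap d H) : Prop :=
  μ.toLinearMap (toSystem 1) =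
      (1 / 2 : ℂ) • (B.herglotzLeft [] + star (B.herglotzLeft [])) ∧
    ∀ α : Word d, α ≠ [] →
      star (μ.toLinearMap (toSystem (shiftWord α.reverse))) = (1 / 2 : ℂ) • B.herglotzLeft α

namespace SchurPair

/-- The right free de Branges–Rovnyak space `ℋ^R(B)`: the reproducing kernel Hilbert space of
`H`-valued power series (coefficient functions on words) with kernel `k̂^R`. -/
abbrev DBR (B : SchurPair d H) := RKHS.OfKernel B.dbrKernel

/-- The right free Herglotz space `ℋ^{R,+}(H_B)`: the reproducing kernel Hilbert space of
`H`-valued power series with kernel `K̂^R`. -/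
abbrev HerglotzSpace (B : SchurPair d H) := RKHS.OfKernel B.herglotzKernel

/-- `𝒞` is the right free Cauchy transform: `𝒞 π_μ(L)^α (I ⊗ h) = K̂^R_α h`. -/
def IsCauchyTransform (B : SchurPair d H) (μ : FreeCPMap d H)
    (𝒞 : μ.FreeHardy ≃ₗᵢ[ℂ] B.HerglotzSpace) : Prop :=
  ∀ (α : Word d) (h : H), 𝒞 (μ.gnsRep (shiftWord α) (μ.toHardy 1 h)) =
    RKHS.kerFun B.HerglotzSpace α h

/-- `M` is free right multiplication by `I - B^R(Z)` from `ℋ^{R,+}(H_B)` to `ℋ^R(B)`. -/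
def IsMulOneSub (B : SchurPair d H) (M : B.HerglotzSpace ≃ₗᵢ[ℂ] B.DBR) : Prop :=
  ∀ f : B.HerglotzSpace, ⇑(M f) = rightMulVec (oneSeries d H - B.right) f

/-- `ℱ` is the weighted right free Cauchy transform `(I - B^R(Z)) •_R 𝒞`. -/
def IsWeightedCauchyTransform (B : SchurPair d H) (μ : FreeCPMap d H)
    (ℱ : μ.FreeHardy ≃ₗᵢ[ℂ] B.DBR) : Prop :=
  ∃ (𝒞 : μ.FreeHardy ≃ₗᵢ[ℂ] B.HerglotzSpace) (M : B.HerglotzSpace ≃ₗᵢ[ℂ] B.DBR),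
    B.IsCauchyTransform μ 𝒞 ∧ B.IsMulOneSub M ∧ ℱ = 𝒞.trans M

/-- The operator `(ℱ ⊗ I_d) π_μ(L)^* ℱ^* : ℋ^R(B) → ℋ^R(B) ⊗ ℂ^d`. -/
def clarkOp (B : SchurPair d H) (μ : FreeCPMap d H) (ℱ : μ.FreeHardy ≃ₗᵢ[ℂ] B.DBR) :
    B.DBR →L[ℂ] PiLp 2 (fun _ : Fin d => B.DBR) :=
  ((LinearIsometryEquiv.piLpCongrRight 2 fun _ : Fin d => ℱ).toContinuousLinearEquiv :
      PiLp 2 (fun _ : Fin d => μ.FreeHardy) →L[ℂ] PiLp 2 (fun _ : Fin d => B.DBR)) ∘L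
    (rowShift μ).adjoint ∘L
      (ℱ.toContinuousLinearEquiv : μ.FreeHardy →L[ℂ] B.DBR).adjoint

/-- The power series `∑_j Z_j G_j(Z)`. -/
def shiftSeries (G : Fin d → Word d → H) : Word d → H
  | [] => 0
  | j :: α => G j α

/-- `A` is a contractive Gleason solution for `B^R`: `Z A(Z) = B^R(Z) - B_∅` and
`A^* A ≤ I - B_∅^* B_∅`. -/
def IsContractiveGleason (B : SchurPair d H)
    (A : H →L[ℂ] PiLp 2 (fun _ : Fin d => B.DBR)) : Prop :=
  (∀ (h : H) (γ : Word d), shiftSeries (fun j => ⇑(A h j)) γ =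
      B.right γ h - oneSeries d H γ (B.right [] h)) ∧
    A.adjoint ∘L A ≤ 1 - star (B.right []) * B.right []

end SchurPair

end Clark

end FreeClark

end

/-! Write `M` for right multiplication by `B^R` on the Fock space and `k_α`, `K_α` for the kernel
vectors of the de Branges–Rovnyak and Herglotz spaces. Nearly every object is built from a total
family of vectors whose Gram matrix is known: equal Gram matrices give isometries, dominated ones
give contractions.

De Branges–Rovnyak side. The vectors `k_α h` have the Gram matrix of `e_α ⊗ h` for the form `1 - M
M^*`, so `e_α ⊗ h ↦ k_α h` extends to a contraction `q` with dense range, and `q^*` is the inclusion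
in the Fock space (`exists_dbrQuot`, `dbrIncl_apply`). Since `M` commutes with every `L_j`,
splitting words by their first letter gives the identity `norm_dbrQuot_add_sq`. It bounds two
operators on the range of `q ⊗ I_d`, whose adjoints are the restricted backward shift and the
Gleason solution; it also makes the row formed by `B_∅^*` and the adjoint of the Gleason solution
contractive, and passing to the adjoint column gives the Gleason inequality.

Herglotz side. With `G = (I - B^R)⁻¹` one has `H^R = 2G - I`, whence `K̂^R = G •_R k̂^R •_R G^*`
(`inner_herglotzKernel`), and multiplication by `I - B^R` is unitary (`exists_mulOneSub`). The
kernel is unchanged when a common first letter is removed and vanishes when the first letters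
differ, so `K_α h ↦ K_{jα} h` defines isometries `V_j` with orthogonal ranges. Fejér means show that
`L^α ↦ V^α` is completely positive (`exists_rowIsometry_cpMap`); compressing by `K_∅` yields the
Clark map. It is unique because completely positive maps are bounded and self-adjoint, while the
words and their adjoints are total.

Intertwining. The vectors `L^α ⊗ h` in the Hardy space have the Gram matrix of `K_α h`, which gives
the Cauchy transform; it carries `π(L_j)^*` to the plain backward shift on coefficients. Conjugating
by `I - B^R` uses the product rule `rightMulVec_cons`, whose extra term `B_{jγ} f_∅`, with `f_∅ = (I
- B_∅)⁻¹ F_∅`, is exactly the perturbation (`clark_apply`). Since `π(L)` is a row isometry, its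
adjoint is a co-isometry, and unitary equivalence preserves this. -/

noncomputable section

open scoped ENNReal ComplexConjugate InnerProductSpace ComplexOrder TensorProduct
open Filter Topology

namespace FreeClark

/-! ### Operators determined by total families and Gram matrices -/

section Extension

variable {ι E F : Type*} [NormedAddCommGroup E] [InnerProductSpace ℂ E]
  [NormedAddCommGroup F] [InnerProductSpace ℂ F]

theorem denseRange_linearCombination {a : ι → E}
    (ha : (Submodule.span ℂ (Set.range a)).topologicalClosure = ⊤) :
    DenseRange (Finsupp.linearCombination ℂ a) := by
  rw [← Submodule.dense_iff_topologicalClosure_eq_top, ← Finsupp.range_linearCombination] at ha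
  exact ha

theorem inner_linearCombination (a : ι → E) (x y : ι →₀ ℂ) :
    ⟪Finsupp.linearCombination ℂ a x, Finsupp.linearCombination ℂ a y⟫_ℂ =
      x.sum fun i c => y.sum fun j e => conj c * e * ⟪a i, a j⟫_ℂ := by
  simp only [Finsupp.linearCombination_apply, Finsupp.sum, sum_inner, inner_sum, inner_smul_left,
    inner_smul_right]
  rw [Finset.sum_comm]
  refine Finset.sum_congr rfl fun i _ => ?_
  rw [Finset.mul_sum]
  exact Finset.sum_congr rfl fun j _ => by ring

/-- A map of a total family which is bounded on its span extends to a bounded operator. -/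
theorem exists_extension [CompleteSpace F] {a : ι → E} {b : ι → F}
    (ha : (Submodule.span ℂ (Set.range a)).topologicalClosure = ⊤) {C : ℝ} (hC : 0 ≤ C)
    (hab : ∀ x, ‖Finsupp.linearCombination ℂ b x‖ ≤ C * ‖Finsupp.linearCombination ℂ a x‖) :
    ∃ T : E →L[ℂ] F, ‖T‖ ≤ C ∧
      ∀ x, T (Finsupp.linearCombination ℂ a x) = Finsupp.linearCombination ℂ b x :=
  ⟨_, LinearMap.opNorm_extendOfNorm_le (denseRange_linearCombination ha) hC hab,
    LinearMap.extendOfNorm_eq (denseRange_linearCombination ha) ⟨C, hab⟩⟩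

/-- Families with the same Gram matrix are intertwined by an isometry when the first is total. -/
theorem exists_linearIsometry_of_inner_eq [CompleteSpace F] {a : ι → E} {b : ι → F}
    (ha : (Submodule.span ℂ (Set.range a)).topologicalClosure = ⊤)
    (hab : ∀ i j, ⟪b i, b j⟫_ℂ = ⟪a i, a j⟫_ℂ) :
    ∃ U : E →ₗᵢ[ℂ] F, ∀ i, U (a i) = b i := by
  have hd := denseRange_linearCombination ha
  have hn : ∀ x, ‖Finsupp.linearCombination ℂ b x‖ = ‖Finsupp.linearCombination ℂ a x‖ := by
    intro x
    have h : ⟪Finsupp.linearCombination ℂ b x, Finsupp.linearCombination ℂ b x⟫_ℂ =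
        ⟪Finsupp.linearCombination ℂ a x, Finsupp.linearCombination ℂ a x⟫_ℂ := by
      rw [inner_linearCombination, inner_linearCombination]
      simp only [hab]
    rw [norm_eq_sqrt_re_inner (𝕜 := ℂ), h, ← norm_eq_sqrt_re_inner]
  have he := LinearMap.extendOfNorm_eq (f := Finsupp.linearCombination ℂ b) hd
    ⟨1, fun x => by rw [hn, one_mul]⟩
  refine ⟨⟨((Finsupp.linearCombination ℂ b).extendOfNorm
    (Finsupp.linearCombination ℂ a)).toLinearMap, fun x => ?_⟩, fun i => ?_⟩
  · refine hd.induction_on (p := fun x => ‖((Finsupp.linearCombination ℂ b).extendOfNorm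
      (Finsupp.linearCombination ℂ a)) x‖ = ‖x‖) x ?_ fun y => ?_
    · exact isClosed_eq (by fun_prop) (by fun_prop)
    · rw [he, hn]
  · simpa using he (Finsupp.single i 1)

/-- Total families with the same Gram matrix are intertwined by a unitary. -/
theorem exists_linearIsometryEquiv_of_inner_eq [CompleteSpace E] [CompleteSpace F]
    {a : ι → E} {b : ι → F}
    (ha : (Submodule.span ℂ (Set.range a)).topologicalClosure = ⊤)
    (hb : (Submodule.span ℂ (Set.range b)).topologicalClosure = ⊤)
    (hab : ∀ i j, ⟪b i, b j⟫_ℂ = ⟪a i, a j⟫_ℂ) :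
    ∃ U : E ≃ₗᵢ[ℂ] F, ∀ i, U (a i) = b i := by
  obtain ⟨U, hU⟩ := exists_linearIsometry_of_inner_eq ha hab
  -- The isometric image of a complete space is closed, and this one contains the total family `b`.
  have hcl : IsClosed (U.toLinearMap.range : Set F) := by
    exact U.isometry.isClosedEmbedding.isClosed_range
  have htop : U.toLinearMap.range = ⊤ := by
    rw [← hcl.submodule_topologicalClosure_eq, eq_top_iff, ← hb]
    refine Submodule.topologicalClosure_mono (Submodule.span_le.2 ?_)
    rintro _ ⟨i, rfl⟩
    exact ⟨a i, hU i⟩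
  exact ⟨LinearIsometryEquiv.ofSurjective U (LinearMap.range_eq_top.1 htop), hU⟩

theorem eq_of_eqOn_total {G : Type*} [NormedAddCommGroup G] [NormedSpace ℂ G]
    {a : ι → E} (ha : (Submodule.span ℂ (Set.range a)).topologicalClosure = ⊤)
    {S T : E →L[ℂ] G} (h : ∀ i, S (a i) = T (a i)) : S = T := by
  refine ContinuousLinearMap.ext_on (s := Set.range a) ?_ ?_
  · rwa [Submodule.dense_iff_topologicalClosure_eq_top]
  · rintro _ ⟨i, rfl⟩
    exact h i

/-- Converts a pointwise norm estimate into the operator order used in the Gleason inequality. -/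
theorem adjoint_comp_self_le_one_sub [CompleteSpace E] [CompleteSpace F] {A : E →L[ℂ] F}
    {T : E →L[ℂ] E} (h : ∀ x, ‖A x‖ ^ 2 + ‖T x‖ ^ 2 ≤ ‖x‖ ^ 2) :
    A.adjoint ∘L A ≤ 1 - star T * T := by
  rw [ContinuousLinearMap.le_def, ContinuousLinearMap.isPositive_def']
  refine ⟨((IsSelfAdjoint.one _).sub (.star_mul_self T)).sub
    (ContinuousLinearMap.isPositive_adjoint_comp_self A).isSelfAdjoint, fun x => ?_⟩
  have e1 := ContinuousLinearMap.apply_norm_sq_eq_inner_adjoint_left T x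
  have e2 := ContinuousLinearMap.apply_norm_sq_eq_inner_adjoint_left A x
  rw [ContinuousLinearMap.reApplyInnerSelf_apply, sub_apply, sub_apply, inner_sub_left,
    inner_sub_left, map_sub, map_sub, one_apply_eq_self, inner_self_eq_norm_sq, ← e2]
  change 0 ≤ ‖x‖ ^ 2 - RCLike.re ⟪(T.adjoint ∘L T) x, x⟫_ℂ - ‖A x‖ ^ 2
  rw [← e1]
  linarith [h x]

theorem ext_inner_total {ι E : Type*} [NormedAddCommGroup E] [InnerProductSpace ℂ E] {a : ι → E}
    (ha : (Submodule.span ℂ (Set.range a)).topologicalClosure = ⊤) {x y : E}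
    (h : ∀ i, ⟪a i, x⟫_ℂ = ⟪a i, y⟫_ℂ) : x = y := by
  have key : innerSL ℂ x = innerSL ℂ y := eq_of_eqOn_total ha fun i => by
    rw [innerSL_apply_apply, innerSL_apply_apply, ← inner_conj_symm, h, inner_conj_symm]
  refine ext_inner_right ℂ fun v => ?_
  rw [← innerSL_apply_apply (𝕜 := ℂ) x, key, innerSL_apply_apply]

/-- Unitaries cancel on either side of `R.adjoint ∘L R`; this is how the co-isometry claim follows
from `π(L)` being a row isometry. -/
theorem comp_adjoint_eq_one_of_isometry {E D P Q : Type*}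
    [NormedAddCommGroup E] [InnerProductSpace ℂ E] [CompleteSpace E]
    [NormedAddCommGroup D] [InnerProductSpace ℂ D] [CompleteSpace D]
    [NormedAddCommGroup P] [InnerProductSpace ℂ P] [CompleteSpace P]
    [NormedAddCommGroup Q] [InnerProductSpace ℂ Q] [CompleteSpace Q]
    (e : E ≃ₗᵢ[ℂ] D) (u : P ≃ₗᵢ[ℂ] Q) {R : P →L[ℂ] E} (hR : R.adjoint ∘L R = 1) :
    ((u.toContinuousLinearEquiv : P →L[ℂ] Q) ∘L R.adjoint ∘L
        (e.toContinuousLinearEquiv : E →L[ℂ] D).adjoint) ∘L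
      ((u.toContinuousLinearEquiv : P →L[ℂ] Q) ∘L R.adjoint ∘L
        (e.toContinuousLinearEquiv : E →L[ℂ] D).adjoint).adjoint = 1 := by
  have he : ∀ x, (e.toContinuousLinearEquiv : E →L[ℂ] D).adjoint (e x) = x := by
    intro x
    refine ext_inner_left ℂ fun y => ?_
    rw [ContinuousLinearMap.adjoint_inner_right]
    exact e.inner_map_map y x
  have hu : ∀ q, u ((u.toContinuousLinearEquiv : P →L[ℂ] Q).adjoint q) = q := by
    intro q
    refine ext_inner_left ℂ fun y => ?_
    obtain ⟨p, rfl⟩ := u.surjective y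
    rw [u.inner_map_map, ContinuousLinearMap.adjoint_inner_right]
    rfl
  ext1 q
  rw [ContinuousLinearMap.adjoint_comp, ContinuousLinearMap.adjoint_comp,
    ContinuousLinearMap.adjoint_adjoint, ContinuousLinearMap.adjoint_adjoint]
  change u (R.adjoint ((e.toContinuousLinearEquiv : E →L[ℂ] D).adjoint
    (e (R ((u.toContinuousLinearEquiv : P →L[ℂ] Q).adjoint q))))) = q
  rw [he, ← ContinuousLinearMap.comp_apply, hR]
  exact hu q

end Extension

/-! ### Totality of kernel vectors and of Fock basis vectors -/

section Total

theorem kerFun_total {X V K : Type*} [NormedAddCommGroup V] [InnerProductSpace ℂ V]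
    [CompleteSpace V] [NormedAddCommGroup K] [InnerProductSpace ℂ K] [CompleteSpace K]
    [RKHS ℂ K X V] : (Submodule.span ℂ (Set.range fun p : X × V =>
      RKHS.kerFun K p.1 p.2)).topologicalClosure = ⊤ := by
  have h : (Set.range fun p : X × V => RKHS.kerFun K p.1 p.2) =
      {RKHS.kerFun K x v | (x) (v)} := by
    ext f
    simp
  rw [h]
  exact RKHS.kerFun_dense K

variable {d : ℕ} {H : Type*} [NormedAddCommGroup H] [InnerProductSpace ℂ H]

theorem basisEmb_apply (α β : Word d) (h : H) :
    basisEmb H α h β = if β = α then h else 0 := by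
  change (Pi.single α h : Word d → H) β = _
  rw [Pi.single_apply]

theorem basisEmb_total : (Submodule.span ℂ (Set.range fun p : Word d × H =>
    basisEmb H p.1 p.2)).topologicalClosure = ⊤ := by
  rw [← Submodule.dense_iff_topologicalClosure_eq_top, dense_iff_closure_eq, Set.eq_univ_iff_forall]
  intro F
  have h := lp.hasSum_single (p := 2) (by norm_num) F
  refine mem_closure_of_tendsto h (Filter.Eventually.of_forall fun s => ?_)
  exact Submodule.sum_mem _ fun α _ => Submodule.subset_span ⟨(α, F α), rfl⟩

end Total

/-! ### Algebra of the right product and transposition -/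

section Series

variable {d : ℕ} {H : Type*} [NormedAddCommGroup H] [InnerProductSpace ℂ H]

theorem sum_range_triangle {R : Type*} [AddCommMonoid R] (n : ℕ) (f : ℕ → ℕ → R) :
    ∑ i ∈ Finset.range (n + 1), ∑ l ∈ Finset.range (i + 1), f l i =
      ∑ l ∈ Finset.range (n + 1), ∑ m ∈ Finset.range (n - l + 1), f l (l + m) := by
  rw [Finset.sum_sigma', Finset.sum_sigma']
  refine Finset.sum_bij' (fun p _ => ⟨p.2, p.1 - p.2⟩) (fun p _ => ⟨p.1 + p.2, p.1⟩) ?_ ?_ ?_ ?_ ?_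
  · rintro ⟨i, l⟩ h; simp only [Finset.mem_sigma, Finset.mem_range] at h ⊢; omega
  · rintro ⟨i, l⟩ h; simp only [Finset.mem_sigma, Finset.mem_range] at h ⊢; omega
  · rintro ⟨i, l⟩ h
    simp only [Finset.mem_sigma, Finset.mem_range] at h
    simp only [Sigma.mk.injEq, heq_eq_eq, and_true]; omega
  · rintro ⟨i, l⟩ h; simp
  · rintro ⟨i, l⟩ h
    simp only [Finset.mem_sigma, Finset.mem_range] at h
    simp only []
    congr 1; omega

theorem rightMulVec_rightMulVec (M N : OpSeries d H) (F : Word d → H) :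
    rightMulVec M (rightMulVec N F) = rightMulVec (rightMul M N) F := by
  funext γ
  simp only [rightMulVec, rightMul, map_sum, _root_.sum_apply]
  trans ∑ i ∈ Finset.range (γ.length + 1), ∑ l ∈ Finset.range (i + 1),
      M (γ.drop i) (N ((γ.take i).drop l) (F (γ.take l)))
  · refine Finset.sum_congr rfl fun i hi => ?_
    rw [Finset.mem_range] at hi
    rw [show (γ.take i).length = i by rw [List.length_take]; omega]
    refine Finset.sum_congr rfl fun l hl => ?_
    rw [Finset.mem_range] at hl
    rw [List.take_take, min_eq_left (by omega)]
  · rw [sum_range_triangle _ fun l i => M (γ.drop i) (N ((γ.take i).drop l) (F (γ.take l)))]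
    refine Finset.sum_congr rfl fun l _ => ?_
    rw [List.length_drop]
    refine Finset.sum_congr rfl fun m _ => ?_
    rw [List.drop_drop, List.take_drop]
    rfl

theorem oneSeries_rightMulVec (F : Word d → H) : rightMulVec (oneSeries d H) F = F := by
  funext γ
  rw [rightMulVec, Finset.sum_range_succ, List.take_length, List.drop_length,
    Finset.sum_eq_zero, zero_add]
  · simp [oneSeries]
  · intro i hi
    rw [Finset.mem_range] at hi
    have : γ.drop i ≠ [] := by simpa using hi
    simp only [oneSeries, if_neg this, zero_apply]

/-- Acting on the constant series `v` returns `M γ v`. Identities between operator series can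
therefore be proved through their action on vector series. -/
theorem ext_rightMulVec {M N : OpSeries d H}
    (h : ∀ F : Word d → H, rightMulVec M F = rightMulVec N F) : M = N := by
  funext γ
  ext v
  have key : ∀ M : OpSeries d H, rightMulVec M (fun α => if α = [] then v else 0) γ = M γ v := by
    intro M
    rw [rightMulVec, Finset.sum_range_succ', Finset.sum_eq_zero]
    · simp
    · intro i hi
      rw [Finset.mem_range] at hi
      have : γ ≠ [] := by rintro rfl; simp at hi
      simp [this]
  rw [← key, ← key, h]

theorem rightMul_assoc (M N P : OpSeries d H) :
    rightMul (rightMul M N) P = rightMul M (rightMul N P) :=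
  ext_rightMulVec fun F => by simp only [← rightMulVec_rightMulVec]

theorem oneSeries_rightMul (F : OpSeries d H) : rightMul (oneSeries d H) F = F :=
  ext_rightMulVec fun G => by rw [← rightMulVec_rightMulVec, oneSeries_rightMulVec]

theorem rightInv_nil (F : OpSeries d H) : rightInv F [] = Ring.inverse (F []) := by
  rw [rightInv]
  simp [oneSeries]

/-- The recursion makes `rightInv F` an inverse on the left only. Its constant term is again a unit,
so it has such an inverse of its own, which associativity forces to be `F`. -/
theorem rightMul_rightInv_self (F : OpSeries d H) (hF : IsUnit (F [])) :
    rightMul F (rightInv F) = oneSeries d H := by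
  have hG : IsUnit (rightInv F []) := by
    rw [rightInv_nil]
    exact hF.ringInverse
  have h1 := rightMul_rightInv (rightInv F) hG
  have h2 := rightMul_rightInv F hF
  have h3 : rightInv (rightInv F) = F := by
    calc rightInv (rightInv F) = rightMul (rightInv (rightInv F)) (rightMul (rightInv F) F) := by
          rw [h2, rightMul_one]
      _ = F := by rw [← rightMul_assoc, h1, oneSeries_rightMul]
  rw [h3] at h1
  exact h1

/-- Cutting a reversed word exchanges prefixes with suffixes, so reflecting the cut position matches
the two sums. -/
theorem rightMul_reverse (M N : OpSeries d H) (γ : Word d) :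
    rightMul (fun α => M α.reverse) (fun α => N α.reverse) γ = leftMul M N γ.reverse := by
  rw [rightMul, leftMul, List.length_reverse, ← Finset.sum_range_reflect]
  refine Finset.sum_congr rfl fun i hi => ?_
  rw [Finset.mem_range] at hi
  rw [List.take_reverse, List.drop_reverse]
  congr 3

theorem rightInv_reverse (F : OpSeries d H) (hF : IsUnit (F [])) :
    rightInv (fun α => F α.reverse) = fun α => leftInv F α.reverse := by
  have h1 : rightMul (fun α => leftInv F α.reverse) (fun α => F α.reverse) = oneSeries d H := by
    funext γ
    rw [rightMul_reverse, leftMul_leftInv F hF]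
    simp [oneSeries]
  have h2 := rightMul_rightInv_self (fun α => F α.reverse) hF
  calc rightInv (fun α => F α.reverse)
      = rightMul (rightMul (fun α => leftInv F α.reverse) (fun α => F α.reverse))
          (rightInv fun α => F α.reverse) := by rw [h1, oneSeries_rightMul]
    _ = _ := by rw [rightMul_assoc, h2, rightMul_one]

end Series

/-! ### Creation operators and the first-letter decomposition of the Fock space -/

section Shift

variable {d : ℕ} {H : Type*} [NormedAddCommGroup H] [InnerProductSpace ℂ H]

theorem leftCreation_basisEmb (j : Fin d) (α : Word d) (h : H) :
    leftCreation H j (basisEmb H α h) = basisEmb H (j :: α) h := by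
  ext β
  rw [leftCreation_apply, basisEmb_apply]
  cases β with
  | nil => simp [consCoeff]
  | cons i β =>
    simp only [consCoeff, basisEmb_apply, List.cons.injEq]
    split_ifs <;> simp_all

/-- In a right product the prefix of the word belongs to `F`, so the first letter `j` is absorbed by
`F` unless that prefix is empty. This product rule for the backward shift is the source of the
perturbation term in the Clark formula. -/
theorem rightMulVec_cons (B : OpSeries d H) (F : Word d → H) (j : Fin d) (γ : Word d) :
    rightMulVec B F (j :: γ) =
      rightMulVec B (fun α => F (j :: α)) γ + B (j :: γ) (F []) := by
  rw [rightMulVec, List.length_cons, Finset.sum_range_succ']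
  simp [rightMulVec]

/-- Right multiplication acts at the end of a word and left creation at its beginning, so the two
commute. -/
theorem rightMulVec_consCoeff (B : OpSeries d H) (F : Word d → H) (j : Fin d) :
    rightMulVec B (consCoeff j F) = consCoeff j (rightMulVec B F) := by
  funext γ
  cases γ with
  | nil => simp [rightMulVec, consCoeff]
  | cons i γ =>
    rw [rightMulVec_cons]
    by_cases h : i = j <;> simp [consCoeff, h, rightMulVec]

/-- The row operator `(L_1, …, L_d)`. -/
def rowCreation (d : ℕ) (H : Type*) [NormedAddCommGroup H] [InnerProductSpace ℂ H] :
    PiLp 2 (fun _ : Fin d => Fock d H) →L[ℂ] Fock d H :=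
  ∑ j : Fin d, leftCreation H j ∘L PiLp.proj 2 (fun _ : Fin d => Fock d H) j

theorem rowCreation_apply (u : PiLp 2 (fun _ : Fin d => Fock d H)) :
    rowCreation d H u = ∑ j, leftCreation H j (u j) := by
  simp [rowCreation]

theorem rowCreation_single (j : Fin d) (F : Fock d H) :
    rowCreation d H (WithLp.toLp 2 (Pi.single j F)) = leftCreation H j F := by
  rw [rowCreation_apply, Finset.sum_eq_single j]
  · simp
  · intro i _ hij
    simp [hij]
  · simp

variable [CompleteSpace H]

theorem adjoint_leftCreation_apply (j : Fin d) (F : Fock d H) (α : Word d) :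
    (leftCreation H j).adjoint F α = F (j :: α) := by
  refine ext_inner_left ℂ fun h => ?_
  rw [← inner_basisEmb, ContinuousLinearMap.adjoint_inner_right, leftCreation_basisEmb,
    inner_basisEmb]

theorem adjoint_leftCreation_leftCreation (i j : Fin d) (F : Fock d H) :
    (leftCreation H i).adjoint (leftCreation H j F) = if i = j then F else 0 := by
  ext α
  rw [adjoint_leftCreation_apply, leftCreation_apply]
  split_ifs with h <;> simp [consCoeff, h]

theorem adjoint_leftCreation_basisEmb_nil (j : Fin d) (h : H) :
    (leftCreation H j).adjoint (basisEmb H [] h) = 0 := by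
  ext α
  rw [adjoint_leftCreation_apply, basisEmb_apply]
  simp

theorem adjoint_leftCreation_rowCreation (j : Fin d) (u : PiLp 2 (fun _ : Fin d => Fock d H)) :
    (leftCreation H j).adjoint (rowCreation d H u) = u j := by
  rw [rowCreation_apply, map_sum]
  simp [adjoint_leftCreation_leftCreation]

theorem rowCreation_apply_nil (u : PiLp 2 (fun _ : Fin d => Fock d H)) :
    rowCreation d H u [] = 0 := by
  refine ext_inner_left ℂ fun h => ?_
  rw [← inner_basisEmb, rowCreation_apply, inner_sum, inner_zero_right]
  refine Finset.sum_eq_zero fun j _ => ?_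
  rw [← ContinuousLinearMap.adjoint_inner_left, adjoint_leftCreation_basisEmb_nil, inner_zero_left]

/-- A word is either empty or has a unique first letter: the Fock space is the vacuum plus the
orthogonal ranges of the `L_j`. -/
theorem fock_decomposition (w : Fock d H) :
    w = basisEmb H [] (w []) + ∑ j, leftCreation H j ((leftCreation H j).adjoint w) := by
  have e := rowCreation_apply (WithLp.toLp 2 fun j => (leftCreation H j).adjoint w)
  simp only [] at e
  rw [← e]
  ext α
  rw [lp.coeFn_add, Pi.add_apply, basisEmb_apply]
  cases α with
  | nil => simp [rowCreation_apply_nil]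
  | cons j α =>
    rw [← adjoint_leftCreation_apply j (rowCreation d H _), adjoint_leftCreation_rowCreation]
    simp [adjoint_leftCreation_apply]

theorem fock_inner (v w : Fock d H) :
    ⟪v, w⟫_ℂ = ⟪v [], w []⟫_ℂ +
      ∑ j, ⟪(leftCreation H j).adjoint v, (leftCreation H j).adjoint w⟫_ℂ := by
  conv_lhs => rw [fock_decomposition w]
  rw [inner_add_right, inner_sum]
  congr 1
  · rw [← inner_conj_symm, inner_basisEmb, inner_conj_symm]
  · exact Finset.sum_congr rfl fun j _ => by rw [ContinuousLinearMap.adjoint_inner_left]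

theorem fock_norm_sq (w : Fock d H) :
    ‖w‖ ^ 2 = ‖w []‖ ^ 2 + ∑ j, ‖(leftCreation H j).adjoint w‖ ^ 2 := by
  have h := congrArg Complex.re (fock_inner w w)
  simp only [Complex.add_re, Complex.re_sum] at h
  simp only [← inner_self_eq_norm_sq (𝕜 := ℂ)]
  exact h

end Shift

/-! ### The de Branges–Rovnyak space as a quotient of Fock space, and the Gleason solution -/

namespace SchurPair

variable {d : ℕ} {H : Type*} [NormedAddCommGroup H] [InnerProductSpace ℂ H]
  (B : SchurPair d H)

theorem mulRight_basisEmb_nil (h : H) (α : Word d) :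
    B.mulRight (basisEmb H [] h) α = B.right α h := by
  rw [mulRight_apply, rightMulVec, Finset.sum_range_succ', Finset.sum_eq_zero]
  · simp [basisEmb_apply]
  · intro i hi
    rw [Finset.mem_range] at hi
    have : α ≠ [] := by rintro rfl; simp at hi
    simp [basisEmb_apply, this]

variable [CompleteSpace H]

/-- The adjoint form of the commutation of `M` with `L_j`; it lets the defect `1 - M M^*` be split
letter by letter. -/
theorem adjoint_leftCreation_adjoint_mulRight (j : Fin d) (w : Fock d H) :
    (leftCreation H j).adjoint (B.mulRight.adjoint w) =
      B.mulRight.adjoint ((leftCreation H j).adjoint w) := by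
  refine ext_inner_right ℂ fun F => ?_
  rw [ContinuousLinearMap.adjoint_inner_left, ContinuousLinearMap.adjoint_inner_left,
    ContinuousLinearMap.adjoint_inner_left, ContinuousLinearMap.adjoint_inner_left]
  congr 1
  ext α
  rw [mulRight_apply, leftCreation_apply, mulRight_apply, ← rightMulVec_consCoeff]
  rfl

theorem adjoint_mulRight_apply_nil_basisEmb_nil (g : H) :
    B.mulRight.adjoint (basisEmb H [] g) [] = star (B.right []) g := by
  refine ext_inner_left ℂ fun h => ?_
  rw [← inner_basisEmb, ContinuousLinearMap.adjoint_inner_right, ← inner_conj_symm,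
    inner_basisEmb, mulRight_basisEmb_nil, inner_conj_symm, ContinuousLinearMap.star_eq_adjoint,
    ContinuousLinearMap.adjoint_inner_right]

section Kernel

variable {K : Type*} [NormedAddCommGroup K] [InnerProductSpace ℂ K] [CompleteSpace K]
  [RKHS ℂ K (Word d) H]

/-- The double sum in the kernel is the Gram matrix of the vectors `M^* (e_α ⊗ h)`, that is, of the
rows `rowEmb B.right α h`. -/
theorem inner_kerFun_dbr (hK : RKHS.kernel K = B.dbrKernel) (p q : Word d × H) :
    ⟪RKHS.kerFun K p.1 p.2, RKHS.kerFun K q.1 q.2⟫_ℂ =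
      ⟪basisEmb H p.1 p.2, basisEmb H q.1 q.2⟫_ℂ -
        ⟪B.mulRight.adjoint (basisEmb H p.1 p.2), B.mulRight.adjoint (basisEmb H q.1 q.2)⟫_ℂ := by
  rw [RKHS.kerFun_inner, RKHS.kerFun_apply, hK,
    adjoint_mulRight_basisEmb, adjoint_mulRight_basisEmb, inner_rowEmb_rowEmb, dbrKernel,
    sub_apply, inner_sub_right, inner_basisEmb, basisEmb_apply]
  congr 2
  split_ifs <;> simp

theorem inner_linearCombination_kerFun_dbr (hK : RKHS.kernel K = B.dbrKernel)
    (x y : Word d × H →₀ ℂ) :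
    ⟪Finsupp.linearCombination ℂ (fun p => RKHS.kerFun K p.1 p.2) x,
        Finsupp.linearCombination ℂ (fun p => RKHS.kerFun K p.1 p.2) y⟫_ℂ =
      ⟪Finsupp.linearCombination ℂ (fun p => basisEmb H p.1 p.2) x,
          Finsupp.linearCombination ℂ (fun p => basisEmb H p.1 p.2) y⟫_ℂ -
        ⟪B.mulRight.adjoint (Finsupp.linearCombination ℂ (fun p => basisEmb H p.1 p.2) x),
          B.mulRight.adjoint (Finsupp.linearCombination ℂ (fun p => basisEmb H p.1 p.2) y)⟫_ℂ := by
  have e : ∀ x : Word d × H →₀ ℂ,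
      B.mulRight.adjoint (Finsupp.linearCombination ℂ (fun p => basisEmb H p.1 p.2) x) =
        Finsupp.linearCombination ℂ (fun p => B.mulRight.adjoint (basisEmb H p.1 p.2)) x := by
    intro x
    simp [Finsupp.linearCombination_apply, Finsupp.sum]
  rw [e, e, inner_linearCombination, inner_linearCombination, inner_linearCombination]
  simp only [B.inner_kerFun_dbr hK, mul_sub, Finsupp.sum, Finset.sum_sub_distrib]

/-- The quotient map from the Fock space onto a dense subspace of a space with kernel `k̂^R`. -/
theorem exists_dbrQuot (hK : RKHS.kernel K = B.dbrKernel) : ∃ q : Fock d H →L[ℂ] K,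
    ‖q‖ ≤ 1 ∧ DenseRange q ∧ (∀ α h, q (basisEmb H α h) = RKHS.kerFun K α h) ∧
      ∀ u v, ⟪q u, q v⟫_ℂ = ⟪u, v⟫_ℂ - ⟪B.mulRight.adjoint u, B.mulRight.adjoint v⟫_ℂ := by
  have hn : ∀ x, ‖Finsupp.linearCombination ℂ (fun p : Word d × H => RKHS.kerFun K p.1 p.2) x‖ ≤
      1 * ‖Finsupp.linearCombination ℂ (fun p : Word d × H => basisEmb H p.1 p.2) x‖ := by
    intro x
    rw [one_mul]
    have h := congrArg RCLike.re (B.inner_linearCombination_kerFun_dbr hK x x)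
    rw [map_sub, inner_self_eq_norm_sq, inner_self_eq_norm_sq, inner_self_eq_norm_sq] at h
    refine le_of_sq_le_sq ?_ (norm_nonneg _)
    rw [h]
    exact sub_le_self _ (sq_nonneg _)
  obtain ⟨q, hq, hqx⟩ := exists_extension (basisEmb_total (d := d) (H := H)) zero_le_one hn
  refine ⟨q, hq, ?_, fun α h => ?_, fun u v => ?_⟩
  · refine (denseRange_linearCombination (kerFun_total (K := K))).mono ?_
    rintro _ ⟨x, rfl⟩
    exact ⟨_, hqx x⟩
  · simpa using hqx (Finsupp.single (α, h) 1)
  · refine (denseRange_linearCombination (basisEmb_total (d := d) (H := H))).induction_on₂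
      (p := fun u v => ⟪q u, q v⟫_ℂ =
        ⟪u, v⟫_ℂ - ⟪B.mulRight.adjoint u, B.mulRight.adjoint v⟫_ℂ) ?_ (fun x y => ?_) u v
    · exact isClosed_eq (by fun_prop) (by fun_prop)
    · rw [hqx, hqx]
      exact B.inner_linearCombination_kerFun_dbr hK x y

end Kernel

/-- The map `e_α ⊗ h ↦ k̂^R_α h` from the Fock space onto a dense subspace of `ℋ^R(B)`. -/
def dbrQuot : Fock d H →L[ℂ] B.DBR :=
  (B.exists_dbrQuot (K := B.DBR) RKHS.OfKernel.kernel_ofKernel).choose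

theorem norm_dbrQuot_le : ‖B.dbrQuot‖ ≤ 1 :=
  (B.exists_dbrQuot (K := B.DBR) RKHS.OfKernel.kernel_ofKernel).choose_spec.1

theorem denseRange_dbrQuot : DenseRange B.dbrQuot :=
  (B.exists_dbrQuot (K := B.DBR) RKHS.OfKernel.kernel_ofKernel).choose_spec.2.1

theorem dbrQuot_basisEmb (α : Word d) (h : H) :
    B.dbrQuot (basisEmb H α h) = RKHS.kerFun B.DBR α h :=
  (B.exists_dbrQuot (K := B.DBR) RKHS.OfKernel.kernel_ofKernel).choose_spec.2.2.1 α h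

theorem inner_dbrQuot (u v : Fock d H) :
    ⟪B.dbrQuot u, B.dbrQuot v⟫_ℂ =
      ⟪u, v⟫_ℂ - ⟪B.mulRight.adjoint u, B.mulRight.adjoint v⟫_ℂ :=
  (B.exists_dbrQuot (K := B.DBR) RKHS.OfKernel.kernel_ofKernel).choose_spec.2.2.2 u v

theorem norm_dbrQuot_sq (u : Fock d H) :
    ‖B.dbrQuot u‖ ^ 2 = ‖u‖ ^ 2 - ‖B.mulRight.adjoint u‖ ^ 2 := by
  have h := congrArg Complex.re (B.inner_dbrQuot u u)
  rw [Complex.sub_re] at h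
  simp only [← inner_self_eq_norm_sq (𝕜 := ℂ)]
  exact h

/-- The contractive inclusion of `ℋ^R(B)` in the Fock space. -/
def dbrIncl : B.DBR →L[ℂ] Fock d H := B.dbrQuot.adjoint

theorem norm_dbrIncl_le : ‖B.dbrIncl‖ ≤ 1 := by
  rw [dbrIncl, LinearIsometryEquiv.norm_map]
  exact B.norm_dbrQuot_le

/-- Pairing the adjoint of the quotient map with `e_α ⊗ h` is pairing `F` with a kernel vector, so
coefficients are unchanged. -/
theorem dbrIncl_apply (F : B.DBR) : ⇑(B.dbrIncl F) = ⇑F := by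
  funext α
  refine ext_inner_left ℂ fun h => ?_
  rw [← inner_basisEmb, dbrIncl, ContinuousLinearMap.adjoint_inner_right, dbrQuot_basisEmb,
    RKHS.kerFun_inner]

/-- The coordinatewise map `(ℱ²_d ⊗ H) ⊗ ℂ^d → ℋ^R(B) ⊗ ℂ^d`. -/
def dbrQuotPi : PiLp 2 (fun _ : Fin d => Fock d H) →ₗ[ℂ] PiLp 2 (fun _ : Fin d => B.DBR) where
  toFun u := WithLp.toLp 2 fun j => B.dbrQuot (u j)
  map_add' u v := by ext j : 1; simp
  map_smul' c u := by ext j : 1; simp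

theorem dbrQuotPi_apply (u : PiLp 2 (fun _ : Fin d => Fock d H)) (j : Fin d) :
    B.dbrQuotPi u j = B.dbrQuot (u j) := rfl

theorem denseRange_dbrQuotPi : DenseRange B.dbrQuotPi := by
  have h : DenseRange (Pi.map fun (_ : Fin d) => ⇑B.dbrQuot) :=
    DenseRange.piMap fun _ => B.denseRange_dbrQuot
  have h2 := (WithLp.toLp_surjective (V := Fin d → B.DBR) 2).denseRange.comp h
    (PiLp.continuous_toLp 2 _)
  refine h2.mono ?_
  rintro _ ⟨u, rfl⟩
  exact ⟨WithLp.toLp 2 u, rfl⟩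

theorem norm_dbrQuotPi_sq (u : PiLp 2 (fun _ : Fin d => Fock d H)) :
    ‖B.dbrQuotPi u‖ ^ 2 = ∑ j, (‖u j‖ ^ 2 - ‖B.mulRight.adjoint (u j)‖ ^ 2) := by
  rw [PiLp.norm_sq_eq_of_L2]
  exact Finset.sum_congr rfl fun j _ => B.norm_dbrQuot_sq (u j)

/-- The contraction inequality behind co-invariance of `ℋ^R(B)` and contractivity of the Gleason
solution. -/
theorem norm_dbrQuot_add_sq (g : H) (u : PiLp 2 (fun _ : Fin d => Fock d H)) :
    ‖B.dbrQuot (basisEmb H [] g + rowCreation d H u)‖ ^ 2 =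
      ‖g‖ ^ 2 + ‖B.dbrQuotPi u‖ ^ 2 -
        ‖star (B.right []) g + B.mulRight.adjoint (rowCreation d H u) []‖ ^ 2 := by
  have h1 : ∀ j, (leftCreation H j).adjoint (basisEmb H [] g + rowCreation d H u) = u j := by
    intro j
    rw [map_add, adjoint_leftCreation_basisEmb_nil, adjoint_leftCreation_rowCreation, zero_add]
  have h2 : (basisEmb H [] g + rowCreation d H u : Fock d H) [] = g := by
    rw [lp.coeFn_add, Pi.add_apply, basisEmb_apply, rowCreation_apply_nil]
    simp
  -- Both terms of the defect form are split into vacuum and first-letter parts; the letter parts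
  -- recombine into the defect forms of the `u j`, leaving only the vacuum terms.
  rw [norm_dbrQuot_sq, fock_norm_sq, h2, fock_norm_sq (B.mulRight.adjoint _), norm_dbrQuotPi_sq,
    Finset.sum_sub_distrib]
  simp only [adjoint_leftCreation_adjoint_mulRight, h1]
  rw [map_add, lp.coeFn_add, Pi.add_apply, adjoint_mulRight_apply_nil_basisEmb_nil]
  ring

/-- The adjoint of the restriction of `L^* ⊗ I` to `ℋ^R(B)`. -/
def shiftAdj : PiLp 2 (fun _ : Fin d => B.DBR) →L[ℂ] B.DBR :=
  (B.dbrQuot ∘L rowCreation d H).toLinearMap.extendOfNorm B.dbrQuotPi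

/-- Evaluation of a Fock space element at a word. -/
def evalWord (α : Word d) : Fock d H →L[ℂ] H := (basisEmb H α).adjoint

theorem evalWord_apply (α : Word d) (F : Fock d H) : evalWord α F = F α := by
  refine ext_inner_left ℂ fun h => ?_
  rw [evalWord, ContinuousLinearMap.adjoint_inner_right, inner_basisEmb]

/-- The adjoint of the Gleason solution. -/
def gleasonAdj : PiLp 2 (fun _ : Fin d => B.DBR) →L[ℂ] H :=
  (evalWord [] ∘L B.mulRight.adjoint ∘L rowCreation d H).toLinearMap.extendOfNorm B.dbrQuotPi

/-- At `g = 0` the identity `norm_dbrQuot_add_sq` writes `‖B.dbrQuotPi u‖ ^ 2` as a sum of two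
squares. Each summand is hence dominated, here and in `gleasonAdj_bound`, which makes both
assignments well defined on the dense range of `B.dbrQuotPi`. -/
theorem shiftAdj_bound (u : PiLp 2 (fun _ : Fin d => Fock d H)) :
    ‖(B.dbrQuot ∘L rowCreation d H).toLinearMap u‖ ≤ 1 * ‖B.dbrQuotPi u‖ := by
  have h := B.norm_dbrQuot_add_sq 0 u
  simp only [map_zero, zero_add, norm_zero] at h
  rw [one_mul]
  refine le_of_sq_le_sq ?_ (norm_nonneg _)
  change ‖B.dbrQuot (rowCreation d H u)‖ ^ 2 ≤ _
  rw [h]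
  nlinarith [sq_nonneg ‖B.mulRight.adjoint (rowCreation d H u) []‖]

theorem gleasonAdj_bound (u : PiLp 2 (fun _ : Fin d => Fock d H)) :
    ‖(evalWord [] ∘L B.mulRight.adjoint ∘L rowCreation d H).toLinearMap u‖ ≤
      1 * ‖B.dbrQuotPi u‖ := by
  have h := B.norm_dbrQuot_add_sq 0 u
  simp only [map_zero, zero_add, norm_zero] at h
  rw [one_mul]
  refine le_of_sq_le_sq ?_ (norm_nonneg _)
  change ‖evalWord [] (B.mulRight.adjoint (rowCreation d H u))‖ ^ 2 ≤ _
  rw [evalWord_apply]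
  nlinarith [sq_nonneg ‖B.dbrQuot (rowCreation d H u)‖]

theorem shiftAdj_dbrQuotPi (u : PiLp 2 (fun _ : Fin d => Fock d H)) :
    B.shiftAdj (B.dbrQuotPi u) = B.dbrQuot (rowCreation d H u) :=
  LinearMap.extendOfNorm_eq B.denseRange_dbrQuotPi ⟨1, B.shiftAdj_bound⟩ u

theorem gleasonAdj_dbrQuotPi (u : PiLp 2 (fun _ : Fin d => Fock d H)) :
    B.gleasonAdj (B.dbrQuotPi u) = B.mulRight.adjoint (rowCreation d H u) [] :=
  (LinearMap.extendOfNorm_eq B.denseRange_dbrQuotPi ⟨1, B.gleasonAdj_bound⟩ u).trans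
    (evalWord_apply _ _)

/-- The restriction of `L^* ⊗ I` to `ℋ^R(B)`. -/
def dbrShift : B.DBR →L[ℂ] PiLp 2 (fun _ : Fin d => B.DBR) := B.shiftAdj.adjoint

/-- The contractive Gleason solution `(L^* ⊗ I) B^R`. -/
def gleason : H →L[ℂ] PiLp 2 (fun _ : Fin d => B.DBR) := B.gleasonAdj.adjoint

theorem inner_dbrQuotPi_single (j : Fin d) (F : Fock d H) (G : PiLp 2 (fun _ : Fin d => B.DBR)) :
    ⟪B.dbrQuotPi (WithLp.toLp 2 (Pi.single j F)), G⟫_ℂ = ⟪B.dbrQuot F, G j⟫_ℂ := by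
  rw [PiLp.inner_apply, Finset.sum_eq_single j]
  · simp [dbrQuotPi_apply]
  · intro i _ hij
    simp [dbrQuotPi_apply, hij]
  · simp

theorem dbrIncl_dbrShift (F : B.DBR) (j : Fin d) :
    B.dbrIncl (B.dbrShift F j) = (leftCreation H j).adjoint (B.dbrIncl F) := by
  refine ext_inner_left ℂ fun u => ?_
  rw [dbrIncl, ContinuousLinearMap.adjoint_inner_right, ← inner_dbrQuotPi_single, dbrShift,
    ContinuousLinearMap.adjoint_inner_right, shiftAdj_dbrQuotPi, rowCreation_single,
    ContinuousLinearMap.adjoint_inner_right, ContinuousLinearMap.adjoint_inner_right]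

theorem dbrIncl_gleason (h : H) (j : Fin d) :
    B.dbrIncl (B.gleason h j) =
      (leftCreation H j).adjoint (B.mulRight (basisEmb H [] h)) := by
  refine ext_inner_left ℂ fun u => ?_
  rw [dbrIncl, ContinuousLinearMap.adjoint_inner_right, ← inner_dbrQuotPi_single, gleason,
    ContinuousLinearMap.adjoint_inner_right, gleasonAdj_dbrQuotPi, rowCreation_single,
    ContinuousLinearMap.adjoint_inner_right, ← inner_conj_symm, ← inner_basisEmb, inner_conj_symm,
    ContinuousLinearMap.adjoint_inner_left]

theorem dbrShift_apply (F : B.DBR) (j : Fin d) (α : Word d) :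
    B.dbrShift F j α = F (j :: α) := by
  rw [← dbrIncl_apply, dbrIncl_dbrShift, adjoint_leftCreation_apply, dbrIncl_apply]

theorem gleason_apply (h : H) (j : Fin d) (α : Word d) :
    B.gleason h j α = B.right (j :: α) h := by
  rw [← dbrIncl_apply, dbrIncl_gleason, adjoint_leftCreation_apply, mulRight_basisEmb_nil]

/-- On the dense range, the difference of the two sides is the square norm of a vector of the de
Branges–Rovnyak space, by `norm_dbrQuot_add_sq`. -/
theorem norm_gleasonAdj_add_sq_le (g : H) (u : PiLp 2 (fun _ : Fin d => B.DBR)) :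
    ‖star (B.right []) g + B.gleasonAdj u‖ ^ 2 ≤ ‖g‖ ^ 2 + ‖u‖ ^ 2 := by
  refine B.denseRange_dbrQuotPi.induction_on
    (p := fun u => ‖star (B.right []) g + B.gleasonAdj u‖ ^ 2 ≤ ‖g‖ ^ 2 + ‖u‖ ^ 2) u
    (isClosed_le (by fun_prop) (by fun_prop)) fun v => ?_
  rw [gleasonAdj_dbrQuotPi]
  nlinarith [B.norm_dbrQuot_add_sq g v,
    sq_nonneg ‖B.dbrQuot (basisEmb H [] g + rowCreation d H v)‖]

/-- The column formed by `B_∅` and the Gleason solution is the adjoint of the contractive row of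
`norm_gleasonAdj_add_sq_le`. -/
theorem norm_gleason_sq_le (h : H) :
    ‖B.gleason h‖ ^ 2 + ‖B.right [] h‖ ^ 2 ≤ ‖h‖ ^ 2 := by
  -- `y = T T^* h` for that row `T`. With `N = ‖T^* h‖ ^ 2`, contractivity gives `‖y‖ ^ 2 ≤ N` and
  -- Cauchy–Schwarz gives `N ≤ ‖h‖ * ‖y‖`; together they force `‖y‖ ≤ ‖h‖`, and so `N ≤ ‖h‖ ^ 2`.
  set y := star (B.right []) (B.right [] h) + B.gleasonAdj (B.gleason h) with hy
  have h1 : ‖y‖ ^ 2 ≤ ‖B.right [] h‖ ^ 2 + ‖B.gleason h‖ ^ 2 := B.norm_gleasonAdj_add_sq_le _ _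
  have h2 : ‖B.right [] h‖ ^ 2 + ‖B.gleason h‖ ^ 2 ≤ ‖h‖ * ‖y‖ := by
    have e : ⟪h, y⟫_ℂ = ⟪B.right [] h, B.right [] h⟫_ℂ + ⟪B.gleason h, B.gleason h⟫_ℂ := by
      rw [hy, inner_add_right, ContinuousLinearMap.star_eq_adjoint,
        ContinuousLinearMap.adjoint_inner_right]
      congr 1
      rw [gleason, ContinuousLinearMap.adjoint_inner_left]
    have e2 : ‖B.right [] h‖ ^ 2 + ‖B.gleason h‖ ^ 2 = RCLike.re ⟪h, y⟫_ℂ := by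
      rw [e, map_add, inner_self_eq_norm_sq, inner_self_eq_norm_sq]
    rw [e2]
    exact re_inner_le_norm h y
  have h3 : ‖y‖ ≤ ‖h‖ := by
    by_contra hc
    push Not at hc
    nlinarith [norm_nonneg h, norm_nonneg y]
  nlinarith [norm_nonneg h, norm_nonneg y]

/-- The Gleason equation at the word `j :: α` reads off the coefficient of `A h j` at `α`, and a
vector of the space is determined by its coefficients. -/
theorem isContractiveGleason_iff (A : H →L[ℂ] PiLp 2 (fun _ : Fin d => B.DBR)) :
    B.IsContractiveGleason A ↔ A = B.gleason := by
  constructor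
  · intro hA
    ext h j α
    have := hA.1 h (j :: α)
    rw [gleason_apply]
    simpa [shiftSeries, oneSeries] using this
  · rintro rfl
    refine ⟨fun h γ => ?_, ?_⟩
    · cases γ with
      | nil => simp [shiftSeries, oneSeries]
      | cons j γ => simp [shiftSeries, oneSeries, gleason_apply]
    · exact adjoint_comp_self_le_one_sub B.norm_gleason_sq_le

end SchurPair

/-! ### Vectors representing the coefficients of a right product -/

section KerRow

variable {d : ℕ} {H : Type*} [NormedAddCommGroup H] [InnerProductSpace ℂ H] [CompleteSpace H]

/-- Both sides represent the functional taking `X` to the `γ` coefficient of `F •_R G •_R X` paired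
with `h`; the identity is associativity in dual form. -/
theorem sum_rowEmb (F G : OpSeries d H) (γ : Word d) (h : H) :
    ∑ i ∈ Finset.range (γ.length + 1), rowEmb G (γ.take i) (star (F (γ.drop i)) h) =
      rowEmb (rightMul F G) γ h := by
  refine ext_inner_right ℂ fun X => ?_
  rw [inner_rowEmb_left, ← rightMulVec_rightMulVec, sum_inner, rightMulVec, inner_sum]
  refine Finset.sum_congr rfl fun i _ => ?_
  rw [inner_rowEmb_left, ContinuousLinearMap.star_eq_adjoint,
    ContinuousLinearMap.adjoint_inner_left]

variable {K : Type*} [NormedAddCommGroup K] [InnerProductSpace ℂ K] [CompleteSpace K]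
  [RKHS ℂ K (Word d) H]

/-- The vector representing `f ↦ ⟨h, (F •_R f)_γ⟩` in a space of power series. -/
def kerRow (K : Type*) [NormedAddCommGroup K] [InnerProductSpace ℂ K] [CompleteSpace K]
    [RKHS ℂ K (Word d) H] (F : OpSeries d H) (γ : Word d) (h : H) : K :=
  ∑ i ∈ Finset.range (γ.length + 1), RKHS.kerFun K (γ.take i) (star (F (γ.drop i)) h)

theorem inner_kerRow (F : OpSeries d H) (γ : Word d) (h : H) (f : K) :
    ⟪kerRow K F γ h, f⟫_ℂ = ⟪h, rightMulVec F f γ⟫_ℂ := by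
  rw [kerRow, sum_inner, rightMulVec, inner_sum]
  refine Finset.sum_congr rfl fun i _ => ?_
  rw [RKHS.kerFun_inner, ContinuousLinearMap.star_eq_adjoint,
    ContinuousLinearMap.adjoint_inner_left]

theorem kerRow_total {F G : OpSeries d H} (h : rightMul G F = oneSeries d H) :
    (Submodule.span ℂ (Set.range fun p : Word d × H =>
      kerRow K F p.1 p.2)).topologicalClosure = ⊤ := by
  rw [eq_top_iff, ← kerFun_total (K := K)]
  refine Submodule.topologicalClosure_mono (Submodule.span_le.2 ?_)
  rintro _ ⟨⟨α, v⟩, rfl⟩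
  -- Multiplying by `G` undoes `F`, so each kernel vector is a finite combination of the rows.
  have e : RKHS.kerFun K α v = ∑ i ∈ Finset.range (α.length + 1),
      kerRow K F (α.take i) (star (G (α.drop i)) v) := by
    refine ext_inner_right ℂ fun f => ?_
    rw [RKHS.kerFun_inner, sum_inner]
    simp only [inner_kerRow, ContinuousLinearMap.star_eq_adjoint,
      ContinuousLinearMap.adjoint_inner_left]
    rw [← inner_sum]
    change _ = ⟪v, rightMulVec G (rightMulVec F f) α⟫_ℂ
    rw [rightMulVec_rightMulVec, h, oneSeries_rightMulVec]
  change RKHS.kerFun K α v ∈ _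
  rw [e]
  exact Submodule.sum_mem _ fun i _ => Submodule.subset_span ⟨(_, _), rfl⟩

end KerRow

/-! ### The Herglotz space: multiplication by `I - B^R` and its row isometry -/

namespace SchurPair

variable {d : ℕ} {H : Type*} [NormedAddCommGroup H] [InnerProductSpace ℂ H]
  (B : SchurPair d H)

theorem isUnit_oneSeries_sub_nil : IsUnit ((oneSeries d H - B.right) []) := by
  simpa [oneSeries] using B.isUnit

/-- Links the two normalisations: the Clark map is prescribed by `H^L`, the kernel by `H^R`. -/
theorem herglotzRight_apply (α : Word d) : B.herglotzRight α = B.herglotzLeft α.reverse := by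
  have h1 : B.right = fun α => B.left α.reverse := funext B.transpose
  have h3 : oneSeries d H - B.right = fun α => (oneSeries d H - B.left) α.reverse := by
    rw [h1]
    funext α
    simp [oneSeries]
  have h4 : oneSeries d H + B.right = fun α => (oneSeries d H + B.left) α.reverse := by
    rw [h1]
    funext α
    simp [oneSeries]
  have h5 : IsUnit ((oneSeries d H - B.left) []) := by
    have := B.isUnit_oneSeries_sub_nil
    rwa [h3] at this
  rw [herglotzRight, herglotzLeft, h4, h3, rightInv_reverse _ h5, rightMul_reverse]

variable [CompleteSpace H]

/-- The factorisation `K̂^R = G •_R k̂^R •_R G^*` with `G = (I - B^R)⁻¹`. It follows from `G •_R B^R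
= G - I` and `H^R = G + G •_R B^R = 2G - I`. -/
theorem inner_herglotzKernel (α β : Word d) (g h : H) :
    ⟪g, B.herglotzKernel α β h⟫_ℂ =
      ⟪rowEmb (rightInv (oneSeries d H - B.right)) α g,
          rowEmb (rightInv (oneSeries d H - B.right)) β h⟫_ℂ -
        ⟪B.mulRight.adjoint (rowEmb (rightInv (oneSeries d H - B.right)) α g),
          B.mulRight.adjoint (rowEmb (rightInv (oneSeries d H - B.right)) β h)⟫_ℂ := by
  set G := rightInv (oneSeries d H - B.right) with hG
  have hinv : rightMul G (oneSeries d H - B.right) = oneSeries d H :=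
    rightMul_rightInv _ B.isUnit_oneSeries_sub_nil
  rw [rightMul_sub, rightMul_one] at hinv
  have hH : B.herglotzRight = G + rightMul G B.right := by
    rw [herglotzRight, ← hG, rightMul_add, rightMul_one]
  have hGB : rightMul G B.right = G - oneSeries d H := by rw [← hinv]; abel
  rw [hGB] at hH
  rw [adjoint_mulRight_rowEmb, adjoint_mulRight_rowEmb, inner_rowEmb_rowEmb,
    inner_rowEmb_rowEmb, ← inner_sub_right, ← sub_apply]
  congr 2
  -- The prefix conditions are rewritten as sums over all pairs of cuts, so that the two sides can
  -- be compared term by term.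
  have e1 := prefix_sum α β (fun γ => B.herglotzRight γ)
  have e2 := prefix_sum β α (fun γ => star (B.herglotzRight γ))
  rw [herglotzKernel, ← e1, ← e2, Finset.sum_comm (s := Finset.range (β.length + 1)),
    ← Finset.sum_add_distrib, Finset.smul_sum, ← Finset.sum_sub_distrib]
  refine Finset.sum_congr rfl fun i _ => ?_
  rw [← Finset.sum_add_distrib, Finset.smul_sum, ← Finset.sum_sub_distrib]
  refine Finset.sum_congr rfl fun j _ => ?_
  by_cases hij : α.take i = β.take j
  · rw [if_pos hij, if_pos hij.symm, if_pos hij, if_pos hij, hGB, hH]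
    simp only [Pi.add_apply, Pi.sub_apply, oneSeries]
    set a := G (α.drop i)
    set b := G (β.drop j)
    -- With `s`, `t` the entries (0 or 1) of the unit series at the two remaining suffixes, this is
    -- `t (2a - s) + s (2b - t)^* = 2 (a b^* - (a - s)(b - t)^*)`.
    rw [one_div, inv_smul_eq_iff₀ two_ne_zero, two_smul]
    split_ifs <;> simp <;> noncomm_ring
  · rw [if_neg hij, if_neg (Ne.symm hij), if_neg hij, if_neg hij]
    simp

/-- An entry depends only on which word is a prefix of the other and on what remains, so a common
first letter can be cancelled. This invariance makes the shifts of kernel vectors isometric. -/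
theorem herglotzKernel_cons (j : Fin d) (α β : Word d) :
    B.herglotzKernel (j :: α) (j :: β) = B.herglotzKernel α β := by
  simp [herglotzKernel, List.cons_prefix_cons]

theorem herglotzKernel_cons_of_ne {i j : Fin d} (hij : i ≠ j) (α β : Word d) :
    B.herglotzKernel (i :: α) (j :: β) = 0 := by
  simp [herglotzKernel, List.cons_prefix_cons, hij, hij.symm]

theorem herglotzKernel_nil_nil :
    B.herglotzKernel [] [] = (1 / 2 : ℂ) • (B.herglotzRight [] + star (B.herglotzRight [])) := by
  simp [herglotzKernel]

theorem herglotzKernel_nil_left {α : Word d} (hα : α ≠ []) :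
    B.herglotzKernel [] α = (1 / 2 : ℂ) • star (B.herglotzRight α) := by
  simp [herglotzKernel, hα]

section Kernel

variable {K : Type*} [NormedAddCommGroup K] [InnerProductSpace ℂ K] [CompleteSpace K]
  [RKHS ℂ K (Word d) H]

theorem inner_kerFun_herglotz (hK : RKHS.kernel K = B.herglotzKernel) (α β : Word d) (g h : H) :
    ⟪RKHS.kerFun K α g, RKHS.kerFun K β h⟫_ℂ = ⟪g, B.herglotzKernel α β h⟫_ℂ := by
  rw [RKHS.kerFun_inner, RKHS.kerFun_apply, hK]

theorem inner_kerRow_kerRow (hK : RKHS.kernel K = B.herglotzKernel) (F : OpSeries d H)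
    (α β : Word d) (g h : H) :
    ⟪kerRow K F α g, kerRow K F β h⟫_ℂ =
      ⟪rowEmb (rightMul F (rightInv (oneSeries d H - B.right))) α g,
          rowEmb (rightMul F (rightInv (oneSeries d H - B.right))) β h⟫_ℂ -
        ⟪B.mulRight.adjoint (rowEmb (rightMul F (rightInv (oneSeries d H - B.right))) α g),
          B.mulRight.adjoint (rowEmb (rightMul F (rightInv (oneSeries d H - B.right))) β h)⟫_ℂ := by
  simp only [← sum_rowEmb, kerRow, map_sum, sum_inner, inner_sum, B.inner_kerFun_herglotz hK,
    inner_herglotzKernel, Finset.sum_sub_distrib]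

/-- Right multiplication by `I - B^R` is unitary from a space with kernel `K̂^R` onto a space with
kernel `k̂^R`. -/
theorem exists_mulOneSub {D : Type*} [NormedAddCommGroup D] [InnerProductSpace ℂ D]
    [CompleteSpace D] [RKHS ℂ D (Word d) H] (hK : RKHS.kernel K = B.herglotzKernel)
    (hD : RKHS.kernel D = B.dbrKernel) :
    ∃ M : K ≃ₗᵢ[ℂ] D, ∀ f : K, ⇑(M f) = rightMulVec (oneSeries d H - B.right) f := by
  have hu := B.isUnit_oneSeries_sub_nil
  -- `J` is the prospective adjoint of multiplication: it sends each kernel vector of `D` to the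
  -- vector of `K` representing the same coefficient of `(I - B^R) •_R f`. The Gram matrices agree
  -- since `(I - B^R) •_R G = I` turns the rows into basis vectors; totality uses the inverse on the
  -- other side.
  obtain ⟨J, hJ⟩ := exists_linearIsometryEquiv_of_inner_eq (kerFun_total (K := D))
    (kerRow_total (K := K) (rightMul_rightInv _ hu)) (fun p q => by
      rw [B.inner_kerRow_kerRow hK, rightMul_rightInv_self _ hu, rowEmb_oneSeries,
        rowEmb_oneSeries, B.inner_kerFun_dbr hD])
  refine ⟨J.symm, fun f => ?_⟩
  funext γ
  refine ext_inner_left ℂ fun h => ?_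
  rw [← inner_kerRow, ← RKHS.kerFun_inner, ← hJ (γ, h), ← J.inner_map_map, J.apply_symm_apply]

/-- The isometries `K̂^R_α h ↦ K̂^R_{jα} h`. -/
theorem exists_herglotzShift (hK : RKHS.kernel K = B.herglotzKernel) :
    ∃ V : Fin d → K →L[ℂ] K, (∀ j α h, V j (RKHS.kerFun K α h) = RKHS.kerFun K (j :: α) h) ∧
      ∀ i j, star (V i) * V j = if i = j then 1 else 0 := by
  have hV : ∀ j : Fin d, ∃ U : K →ₗᵢ[ℂ] K, ∀ p : Word d × H,
      U (RKHS.kerFun K p.1 p.2) = RKHS.kerFun K (j :: p.1) p.2 := fun j =>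
    exists_linearIsometry_of_inner_eq (kerFun_total (K := K)) fun p q => by
      rw [B.inner_kerFun_herglotz hK, B.inner_kerFun_herglotz hK, herglotzKernel_cons]
  choose V hV using hV
  refine ⟨fun j => (V j).toContinuousLinearMap, fun j α h => hV j (α, h), fun i j => ?_⟩
  refine eq_of_eqOn_total (kerFun_total (K := K)) fun p => ?_
  refine RKHS.ext fun α => ext_inner_left ℂ fun h => ?_
  rw [← RKHS.kerFun_inner, ← RKHS.kerFun_inner, ContinuousLinearMap.star_eq_adjoint]
  change ⟪_, (V i).toContinuousLinearMap.adjoint (V j (RKHS.kerFun K p.1 p.2))⟫_ℂ = _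
  rw [ContinuousLinearMap.adjoint_inner_right]
  change ⟪V i (RKHS.kerFun K (α, h).1 (α, h).2), _⟫_ℂ = _
  rw [hV, hV, B.inner_kerFun_herglotz hK]
  split_ifs with hij
  · subst hij
    rw [herglotzKernel_cons, one_apply_eq_self, B.inner_kerFun_herglotz hK]
  · rw [B.herglotzKernel_cons_of_ne hij]
    simp

end Kernel

end SchurPair

/-! ### Words in the creation operators -/

section Words

variable {d : ℕ}

theorem shiftWord_nil : shiftWord ([] : Word d) = 1 := rfl

theorem shiftWord_cons (j : Fin d) (α : Word d) :
    shiftWord (j :: α) = shiftWord [j] * shiftWord α := by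
  simp [shiftWord]

theorem shiftWord_append (α β : Word d) :
    shiftWord (α ++ β) = shiftWord α * shiftWord β := by
  simp [shiftWord]

theorem shiftWord_singleton_coe (j : Fin d) : (shiftWord [j]).1 = leftCreation ℂ j := by
  simp [shiftWord]

theorem shiftWord_cons_coe (j : Fin d) (α : Word d) :
    (shiftWord (j :: α)).1 = leftCreation ℂ j * (shiftWord α).1 := by
  rw [shiftWord_cons, ← shiftWord_singleton_coe]
  rfl

theorem shiftWord_coe (α : Word d) :
    (shiftWord α).1 = (α.map fun j => leftCreation ℂ j).prod := by
  induction α with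
  | nil => rfl
  | cons j α ih => rw [shiftWord_cons_coe, ih, List.map_cons, List.prod_cons]

theorem shiftWord_basisEmb (α β : Word d) (c : ℂ) :
    (shiftWord α).1 (basisEmb ℂ β c) = basisEmb ℂ (α ++ β) c := by
  induction α with
  | nil => rfl
  | cons j α ih =>
    rw [shiftWord_cons_coe]
    change leftCreation ℂ j ((shiftWord α).1 (basisEmb ℂ β c)) = _
    rw [ih, leftCreation_basisEmb]
    rfl

theorem polyAlgebra_eq_span : Subalgebra.toSubmodule (polyAlgebra d) =
    Submodule.span ℂ (Set.range fun α : Word d => (shiftWord α).1) := by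
  rw [polyAlgebra, Algebra.adjoin_eq_span]
  congr 1
  ext x
  constructor
  · intro hx
    induction hx using Submonoid.closure_induction with
    | mem x hx => obtain ⟨j, rfl⟩ := hx; exact ⟨[j], shiftWord_singleton_coe j⟩
    | one => exact ⟨[], rfl⟩
    | mul x y _ _ hx hy =>
      obtain ⟨α, rfl⟩ := hx
      obtain ⟨β, rfl⟩ := hy
      exact ⟨α ++ β, by simp only [shiftWord_append]; rfl⟩
  · rintro ⟨α, rfl⟩
    simp only [shiftWord_coe]
    refine list_prod_mem fun x hx => ?_
    obtain ⟨j, _, rfl⟩ := List.mem_map.1 hx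
    exact Submonoid.subset_closure ⟨j, rfl⟩

/-- Words of length at most `n`. -/
def wordsLE (d : ℕ) : ℕ → Finset (Word d)
  | 0 => {[]}
  | n + 1 => insert [] (Finset.univ.biUnion fun j =>
      (wordsLE d n).map ⟨List.cons j, List.cons_injective⟩)

theorem mem_wordsLE {n : ℕ} {α : Word d} : α ∈ wordsLE d n ↔ α.length ≤ n := by
  induction n generalizing α with
  | zero => simp [wordsLE]
  | succ n ih => cases α <;> simp [wordsLE, ih]

theorem sum_wordsLE_succ {R : Type*} [AddCommMonoid R] (n : ℕ) (f : Word d → R) :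
    ∑ α ∈ wordsLE d (n + 1), f α = f [] + ∑ j, ∑ α ∈ wordsLE d n, f (j :: α) := by
  rw [wordsLE, Finset.sum_insert (by simp), Finset.sum_biUnion]
  · simp
  · intro i _ j _ hij
    rw [Function.onFun, Finset.disjoint_left]
    rintro α hi hj
    simp only [Finset.mem_map, Function.Embedding.coeFn_mk] at hi hj
    obtain ⟨β, _, rfl⟩ := hi
    obtain ⟨γ, _, h⟩ := hj
    exact hij (List.cons.inj h).1.symm

end Words

/-! ### Adjoints and density in the free disk operator system -/

section System

variable {d : ℕ}

theorem star_mem_diskSystem {x : Fock d ℂ →L[ℂ] Fock d ℂ} (hx : x ∈ diskSystem d) :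
    star x ∈ diskSystem d := by
  refine map_mem_closure (continuous_star (R := Fock d ℂ →L[ℂ] Fock d ℂ)) hx fun y hy => ?_
  obtain ⟨a, ha, b, hb, rfl⟩ := Submodule.mem_sup.1 hy
  rw [star_add]
  refine add_mem (Submodule.mem_sup_right ?_) (Submodule.mem_sup_left ?_)
  · change star a ∈ star (diskAlgebra d)
    simpa using ha
  · exact hb

/-- The adjoint of an element of the free disk operator system. -/
def starSystem (x : diskSystem d) : diskSystem d := ⟨star x.1, star_mem_diskSystem x.2⟩

/-- The density principle behind both uniqueness and convergence of completely positive maps: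
linearity reaches polynomials, closedness reaches the disk algebra and its adjoint, then the closure
of their sum. -/
theorem eq_top_of_shiftWord_mem {S : Submodule ℂ (diskSystem d)}
    (hS : IsClosed (S : Set (diskSystem d))) (h1 : ∀ α, toSystem (shiftWord α) ∈ S)
    (h2 : ∀ α, starSystem (toSystem (shiftWord α)) ∈ S) : S = ⊤ := by
  set S' := S.map (diskSystem d).subtype with hS'
  -- The operator system is itself closed, so closedness of `S` survives in the ambient algebra,
  -- where approximants can be handled freely.
  have hcl : IsClosed (S' : Set (Fock d ℂ →L[ℂ] Fock d ℂ)) := by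
    have hc : IsClosed (diskSystem d : Set (Fock d ℂ →L[ℂ] Fock d ℂ)) :=
      Submodule.isClosed_topologicalClosure _
    exact hc.isClosedEmbedding_subtypeVal.isClosedMap _ hS
  have hw : ∀ α, (shiftWord α).1 ∈ S' := fun α => ⟨_, h1 α, rfl⟩
  have hw' : ∀ α, star (shiftWord α).1 ∈ S' := fun α => ⟨_, h2 α, rfl⟩
  have hp : ∀ a ∈ polyAlgebra d, a ∈ S' ∧ star a ∈ S' := by
    intro a ha
    rw [← Subalgebra.mem_toSubmodule, polyAlgebra_eq_span] at ha
    induction ha using Submodule.span_induction with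
    | mem x hx => obtain ⟨α, rfl⟩ := hx; exact ⟨hw α, hw' α⟩
    | zero => simp
    | add x y _ _ hx hy =>
      rw [star_add]
      exact ⟨add_mem hx.1 hy.1, add_mem hx.2 hy.2⟩
    | smul c x _ hx =>
      rw [star_smul]
      exact ⟨S'.smul_mem _ hx.1, S'.smul_mem _ hx.2⟩
  have ha : ∀ a ∈ diskAlgebra d, a ∈ S' ∧ star a ∈ S' := by
    intro a ha
    have ha' : a ∈ closure (polyAlgebra d : Set (Fock d ℂ →L[ℂ] Fock d ℂ)) := by
      rw [← Subalgebra.topologicalClosure_coe]; exact ha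
    constructor
    · exact hcl.closure_subset_iff.2 (fun x hx => (hp x hx).1) ha'
    · exact (hcl.preimage (continuous_star (R := Fock d ℂ →L[ℂ] Fock d ℂ))).closure_subset_iff.2
        (fun x hx => (hp x hx).2) ha'
  have hle : diskSystem d ≤ S' := by
    refine Submodule.topologicalClosure_minimal _ (sup_le (fun a h => (ha a h).1) fun a h => ?_) hcl
    have h' : star a ∈ diskAlgebra d := h
    simpa using (ha _ h').2
  rw [eq_top_iff]
  rintro x -
  obtain ⟨y, hy, hyx⟩ := hle x.2
  rwa [← Subtype.ext hyx]

end System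

/-! ### Self-adjointness, boundedness and limits of completely positive maps -/

namespace FreeCPMap

variable {d : ℕ} {H : Type*} [NormedAddCommGroup H] [InnerProductSpace ℂ H]

theorem ext_toLinearMap {μ ν : FreeCPMap d H} (h : μ.toLinearMap = ν.toLinearMap) : μ = ν := by
  cases μ
  cases ν
  simpa using h

/-- The operator matrix with diagonal `c` and off-diagonal entries `x`, `x^*` is positive when `‖x‖
≤ c`; apply complete positivity at level two. -/
theorem two_by_two (μ : FreeCPMap d H) (x : diskSystem d) {c : ℝ} (hc : ‖x.1‖ ≤ c) (g h : H) :
    0 ≤ (c : ℂ) * ⟪g, μ.toLinearMap (toSystem 1) g⟫_ℂ + ⟪g, μ.toLinearMap x h⟫_ℂ +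
      (⟪h, μ.toLinearMap (starSystem x) g⟫_ℂ +
        (c : ℂ) * ⟪h, μ.toLinearMap (toSystem 1) h⟫_ℂ) := by
  have key := μ.completelyPositive 2
    (fun i j => ![![(c : ℂ) • toSystem 1, x], ![starSystem x, (c : ℂ) • toSystem 1]] i j)
    (fun v => ?_) ![g, h]
  · simpa [Fin.sum_univ_two, inner_smul_right] using key
  · have e1 : ∀ w : Fock d ℂ, (((c : ℂ) • toSystem 1 : diskSystem d) :
        Fock d ℂ →L[ℂ] Fock d ℂ) w = (c : ℂ) • w := fun w => rfl
    have e2 : ⟪v 1, (starSystem x).1 (v 0)⟫_ℂ = conj ⟪v 0, x.1 (v 1)⟫_ℂ := by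
      change ⟪v 1, (star x.1) (v 0)⟫_ℂ = _
      rw [inner_conj_symm, ContinuousLinearMap.star_eq_adjoint,
        ContinuousLinearMap.adjoint_inner_right]
    simp only [Fin.sum_univ_two, Matrix.cons_val_zero, Matrix.cons_val_one, e1,
      inner_smul_right, inner_self_eq_norm_sq_to_K]
    rw [e2]
    have h1 : -(c * ‖v 0‖ * ‖v 1‖) ≤ (⟪v 0, x.1 (v 1)⟫_ℂ).re := by
      have h2 := (abs_le.1 (Complex.abs_re_le_norm ⟪v 0, x.1 (v 1)⟫_ℂ)).1
      have h3 := norm_inner_le_norm (𝕜 := ℂ) (v 0) (x.1 (v 1))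
      have h4 := x.1.le_of_opNorm_le hc (v 1)
      nlinarith [norm_nonneg (v 0), mul_le_mul_of_nonneg_left h4 (norm_nonneg (v 0))]
    have hc0 : 0 ≤ c := (norm_nonneg _).trans hc
    generalize ⟪v 0, x.1 (v 1)⟫_ℂ = z at h1
    rw [Complex.nonneg_iff]
    constructor
    · simp [← Complex.ofReal_pow]
      nlinarith [mul_nonneg hc0 (sq_nonneg (‖v 0‖ - ‖v 1‖))]
    · simp [← Complex.ofReal_pow]

theorem inner_map_one_nonneg (μ : FreeCPMap d H) (h : H) :
    0 ≤ ⟪h, μ.toLinearMap (toSystem 1) h⟫_ℂ := by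
  have := μ.two_by_two 0 (c := 1) (by simp) h 0
  simpa using this

/-- The quantity in `two_by_two` is real, so imaginary parts cancel; replacing `h` by `i h` gives
the corresponding statement for real parts. -/
theorem inner_map_starSystem (μ : FreeCPMap d H) (x : diskSystem d) (g h : H) :
    ⟪h, μ.toLinearMap (starSystem x) g⟫_ℂ = conj ⟪g, μ.toLinearMap x h⟫_ℂ := by
  have key : ∀ h : H, (⟪g, μ.toLinearMap x h⟫_ℂ).im +
      (⟪h, μ.toLinearMap (starSystem x) g⟫_ℂ).im = 0 := by
    intro h
    have h1 := (Complex.nonneg_iff.1 (μ.two_by_two x le_rfl g h)).2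
    have h2 := (Complex.nonneg_iff.1 (μ.inner_map_one_nonneg g)).2
    have h3 := (Complex.nonneg_iff.1 (μ.inner_map_one_nonneg h)).2
    simp only [Complex.add_im, Complex.im_ofReal_mul, ← h2, ← h3] at h1
    linarith
  have h1 := key h
  have h2 := key (Complex.I • h)
  rw [map_smul, inner_smul_right, inner_smul_left] at h2
  simp only [Complex.mul_im, Complex.I_re, Complex.I_im, Complex.conj_I, Complex.neg_re,
    Complex.neg_im] at h2
  apply Complex.ext
  · rw [Complex.conj_re]; linarith
  · rw [Complex.conj_im]; linarith

theorem map_starSystem [CompleteSpace H] (μ : FreeCPMap d H) (x : diskSystem d) :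
    μ.toLinearMap (starSystem x) = star (μ.toLinearMap x) := by
  ext g
  refine ext_inner_left ℂ fun h => ?_
  rw [inner_map_starSystem, inner_conj_symm, ContinuousLinearMap.star_eq_adjoint,
    ContinuousLinearMap.adjoint_inner_right]

theorem norm_map_le (μ : FreeCPMap d H) (x : diskSystem d) :
    ‖μ.toLinearMap x‖ ≤ ‖μ.toLinearMap (toSystem 1)‖ * ‖x‖ := by
  set C := ‖μ.toLinearMap (toSystem 1)‖ with hC
  have key : ∀ g h : H, 0 ≤ ‖x‖ * C * (‖g‖ ^ 2 + ‖h‖ ^ 2) +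
      2 * (⟪g, μ.toLinearMap x h⟫_ℂ).re := by
    intro g h
    have h1 := (Complex.nonneg_iff.1 (μ.two_by_two x le_rfl g h)).1
    rw [inner_map_starSystem] at h1
    simp only [Complex.add_re, Complex.re_ofReal_mul, Complex.conj_re] at h1
    have h2 : ∀ h : H, (⟪h, μ.toLinearMap (toSystem 1) h⟫_ℂ).re ≤ C * ‖h‖ ^ 2 := by
      intro h
      have h3 := (Complex.re_le_norm _).trans
        (norm_inner_le_norm (𝕜 := ℂ) h (μ.toLinearMap (toSystem 1) h))
      have h4 := (μ.toLinearMap (toSystem 1)).le_opNorm h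
      nlinarith [mul_le_mul_of_nonneg_left h4 (norm_nonneg h)]
    have h5 := mul_le_mul_of_nonneg_left (h2 g) (norm_nonneg x)
    have h6 := mul_le_mul_of_nonneg_left (h2 h) (norm_nonneg x)
    have e : ‖x‖ = ‖x.1‖ := rfl
    rw [← e] at h1
    linarith
  refine ContinuousLinearMap.opNorm_le_bound _ (by positivity) fun h => ?_
  set y := μ.toLinearMap x h with hy
  -- The scalings give both test vectors norm `‖h‖ * ‖y‖`, and the sign makes the cross term `-‖h‖ *
  -- ‖y‖ ^ 3`, so the inequality reduces to the wanted bound on `‖y‖`.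
  have h1 := key (-(‖h‖ : ℂ) • y) ((‖y‖ : ℂ) • h)
  rw [map_smul, inner_smul_left, inner_smul_right, ← hy, inner_self_eq_norm_sq_to_K, norm_smul,
    norm_smul, norm_neg, Complex.norm_real, Complex.norm_real, norm_norm, norm_norm] at h1
  have h2 : (conj (-(‖h‖ : ℂ)) * ((‖y‖ : ℂ) * (RCLike.ofReal ‖y‖ : ℂ) ^ 2)).re =
      -(‖h‖ * ‖y‖ ^ 3) := by
    have : conj (-(‖h‖ : ℂ)) * ((‖y‖ : ℂ) * (RCLike.ofReal ‖y‖ : ℂ) ^ 2) =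
      ((-(‖h‖ * ‖y‖ ^ 3) : ℝ) : ℂ) := by
      rw [map_neg, Complex.conj_ofReal]
      push_cast
      simp only [Complex.coe_algebraMap]
      ring
    rw [this, Complex.ofReal_re]
  rw [h2] at h1
  by_contra hcon
  push Not at hcon
  have hh : 0 < ‖h‖ := by
    rw [norm_pos_iff]
    rintro rfl
    simp [hy] at hcon
  have hy0 : 0 < ‖y‖ := lt_of_le_of_lt (by positivity) hcon
  have h3 : 0 < ‖h‖ * ‖y‖ ^ 2 := by positivity
  nlinarith [mul_lt_mul_of_pos_left hcon h3]

theorem continuous_toLinearMap (μ : FreeCPMap d H) : Continuous μ.toLinearMap :=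
  AddMonoidHomClass.continuous_of_bound μ.toLinearMap _ μ.norm_map_le

/-- A completely positive map is determined by its values on the words `L^α`. -/
theorem ext_shiftWord [CompleteSpace H] {μ ν : FreeCPMap d H}
    (h : ∀ α, μ.toLinearMap (toSystem (shiftWord α)) = ν.toLinearMap (toSystem (shiftWord α))) :
    μ = ν := by
  refine ext_toLinearMap (LinearMap.eqLocus_eq_top.1 (eq_top_of_shiftWord_mem ?_ h fun α => ?_))
  · exact isClosed_eq μ.continuous_toLinearMap ν.continuous_toLinearMap
  · rw [LinearMap.mem_eqLocus, map_starSystem, map_starSystem, h]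

/-- Compression `x ↦ W^* μ(x) W` of a completely positive map. -/
def compress {K : Type*} [NormedAddCommGroup K] [InnerProductSpace ℂ K] [CompleteSpace K]
    [CompleteSpace H] (μ : FreeCPMap d K) (W : H →L[ℂ] K) : FreeCPMap d H where
  toLinearMap :=
    { toFun := fun x => W.adjoint ∘L μ.toLinearMap x ∘L W
      map_add' := fun x y => by ext; simp
      map_smul' := fun c x => by ext; simp }
  completelyPositive n x hx h := by
    have := μ.completelyPositive n x hx fun i => W (h i)
    simpa [ContinuousLinearMap.adjoint_inner_right] using this

theorem compress_apply {K : Type*} [NormedAddCommGroup K] [InnerProductSpace ℂ K]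
    [CompleteSpace K] [CompleteSpace H] (μ : FreeCPMap d K) (W : H →L[ℂ] K) (x : diskSystem d) :
    (μ.compress W).toLinearMap x = W.adjoint ∘L μ.toLinearMap x ∘L W := rfl

/-- An `ε / 3` argument: the maps share a Lipschitz constant. In the proof `|C| + 1` replaces `C` to
have a positive denominator. -/
theorem isClosed_setOf_cauchySeq {X Y : Type*} [NormedAddCommGroup X] [NormedAddCommGroup Y]
    {T : ℕ → X → Y} {C : ℝ} (hT : ∀ n x y, ‖T n x - T n y‖ ≤ C * ‖x - y‖) :
    IsClosed {x | CauchySeq fun n => T n x} := by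
  refine isClosed_of_closure_subset fun x hx => ?_
  rw [Set.mem_ofPred_eq, Metric.cauchySeq_iff]
  intro ε hε
  have hC : 0 < |C| + 1 := by positivity
  obtain ⟨y, hy, hxy⟩ := Metric.mem_closure_iff.1 hx (ε / (3 * (|C| + 1))) (by positivity)
  obtain ⟨N, hN⟩ := Metric.cauchySeq_iff.1 hy (ε / 3) (by positivity)
  have hb : ∀ n, dist (T n x) (T n y) < ε / 3 := by
    intro n
    rw [dist_eq_norm]
    rw [dist_eq_norm, lt_div_iff₀ (by positivity)] at hxy
    have h1 := hT n x y
    have h2 := mul_le_mul_of_nonneg_right (le_abs_self C) (norm_nonneg (x - y))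
    have h3 := norm_nonneg (x - y)
    nlinarith
  refine ⟨N, fun m hm n hn => ?_⟩
  have h1 := dist_triangle4 (T m x) (T m y) (T n y) (T n x)
  have h2 := hN m hm n hn
  have h3 := hb m
  have h4 := hb n
  rw [dist_comm] at h4
  linarith

/-- Completely positive maps which are uniformly bounded and converge on words converge. -/
theorem exists_limit [CompleteSpace H] (μ : ℕ → FreeCPMap d H) {C : ℝ}
    (hC : ∀ n, ‖(μ n).toLinearMap (toSystem 1)‖ ≤ C) (A : Word d → H →L[ℂ] H)
    (hA : ∀ α, Tendsto (fun n => (μ n).toLinearMap (toSystem (shiftWord α))) atTop (𝓝 (A α))) :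
    ∃ ν : FreeCPMap d H, ∀ α, ν.toLinearMap (toSystem (shiftWord α)) = A α := by
  have hcau : ∀ x : diskSystem d, CauchySeq fun n => (μ n).toLinearMap x := by
    -- Convergence on words is propagated by showing that the points of convergence form a closed
    -- subspace containing the words and their adjoints.
    let S : Submodule ℂ (diskSystem d) :=
      { carrier := {x | CauchySeq fun n => (μ n).toLinearMap x}
        add_mem' := fun {x y} hx hy => by
          have := CauchySeq.add hx hy
          change CauchySeq fun n => (μ n).toLinearMap (x + y)
          simp only [map_add]
          exact this
        zero_mem' := by simpa using cauchySeq_const (0 : H →L[ℂ] H)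
        smul_mem' := fun c x hx => by
          obtain ⟨y, hy⟩ := cauchySeq_tendsto_of_complete hx
          have := (hy.const_smul c).cauchySeq
          change CauchySeq fun n => (μ n).toLinearMap (c • x)
          simpa only [map_smul] using this }
    have hS : S = ⊤ := by
      refine eq_top_of_shiftWord_mem ?_ (fun α => (hA α).cauchySeq) fun α => ?_
      · refine isClosed_setOf_cauchySeq (C := C) fun n x y => ?_
        rw [← map_sub]
        exact ((μ n).norm_map_le _).trans (mul_le_mul_of_nonneg_right (hC n) (norm_nonneg _))
      · change CauchySeq fun n => (μ n).toLinearMap (starSystem (toSystem (shiftWord α)))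
        simp only [map_starSystem]
        exact ((hA α).star).cauchySeq
    intro x
    have : x ∈ S := hS ▸ Submodule.mem_top
    exact this
  choose f hf using fun x => cauchySeq_tendsto_of_complete (hcau x)
  refine ⟨⟨linearMapOfTendsto f (fun n => (μ n).toLinearMap) (tendsto_pi_nhds.2 hf),
    fun n x hx h => ?_⟩, fun α => tendsto_nhds_unique (hf _) (hA α)⟩
  -- Each positivity condition involves finitely many matrix entries, so it passes to the pointwise
  -- limit.
  refine ge_of_tendsto' (x := atTop) (f := fun k : ℕ =>
    ∑ i, ∑ j, ⟪h i, (μ k).toLinearMap (x i j) (h j)⟫_ℂ) ?_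
    fun k => (μ k).completelyPositive n x hx h
  refine tendsto_finsetSum _ fun i _ => tendsto_finsetSum _ fun j _ => ?_
  exact Tendsto.inner tendsto_const_nhds
    (((ContinuousLinearMap.apply ℂ H (h j)).continuous.tendsto _).comp (hf (x i j)))

end FreeCPMap

/-! ### Fejér means: the functional calculus of a row isometry is completely positive -/

section Fejer

variable {d : ℕ} {K : Type*} [NormedAddCommGroup K] [InnerProductSpace ℂ K]

/-- Schur's product theorem for a positive scalar matrix and a Gram matrix. -/
theorem sum_mul_inner_nonneg {ι : Type*} [Fintype ι] (A : ι → ι → ℂ)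
    (hA : ∀ c : ι → ℂ, 0 ≤ ∑ p, ∑ q, conj (c p) * A p q * c q) (u : ι → K) :
    0 ≤ ∑ p, ∑ q, A p q * ⟪u p, u q⟫_ℂ := by
  -- In an orthonormal basis of the span, the Gram matrix is a finite sum of rank-one matrices, each
  -- of which pairs nonnegatively with `A`.
  set S := Submodule.span ℂ (Set.range u) with hS
  have : FiniteDimensional ℂ S := FiniteDimensional.span_of_finite ℂ (Set.finite_range u)
  set b := stdOrthonormalBasis ℂ S
  let w : ι → S := fun p => ⟨u p, Submodule.subset_span ⟨p, rfl⟩⟩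
  have e : ∑ p, ∑ q, A p q * ⟪u p, u q⟫_ℂ =
      ∑ k, ∑ p, ∑ q, conj (⟪b k, w p⟫_ℂ) * A p q * ⟪b k, w q⟫_ℂ := by
    have h : ∀ p q, A p q * ⟪u p, u q⟫_ℂ =
        ∑ k, conj (⟪b k, w p⟫_ℂ) * A p q * ⟪b k, w q⟫_ℂ := by
      intro p q
      change A p q * ⟪w p, w q⟫_ℂ = _
      rw [← b.sum_inner_mul_inner, Finset.mul_sum]
      refine Finset.sum_congr rfl fun k _ => ?_
      rw [inner_conj_symm]
      ring
    simp only [h]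
    rw [Finset.sum_comm (s := (Finset.univ : Finset (Fin _)))]
    exact Finset.sum_congr rfl fun p _ => Finset.sum_comm
  rw [e]
  exact Finset.sum_nonneg fun k _ => hA _

/-- The product `V^α` of the operators `V_j`. -/
def wordOp (V : Fin d → K →L[ℂ] K) (α : Word d) : K →L[ℂ] K := (α.map V).prod

theorem wordOp_nil (V : Fin d → K →L[ℂ] K) : wordOp V [] = 1 := rfl

theorem wordOp_cons (V : Fin d → K →L[ℂ] K) (j : Fin d) (α : Word d) :
    wordOp V (j :: α) = V j * wordOp V α := by
  simp [wordOp]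

theorem wordOp_append (V : Fin d → K →L[ℂ] K) (α β : Word d) :
    wordOp V (α ++ β) = wordOp V α * wordOp V β := by
  simp [wordOp]

/-- The matrix coefficient `⟨e_α, x e_β⟩`. -/
def matCoeff (α β : Word d) : (Fock d ℂ →L[ℂ] Fock d ℂ) →ₗ[ℂ] ℂ where
  toFun x := x (basisEmb ℂ β 1) α
  map_add' _ _ := rfl
  map_smul' _ _ := rfl

theorem matCoeff_shiftWord (α β γ : Word d) :
    matCoeff α β (shiftWord γ).1 = if α = γ ++ β then 1 else 0 := by
  change (shiftWord γ).1 (basisEmb ℂ β 1) α = _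
  rw [shiftWord_basisEmb, basisEmb_apply]

theorem inner_sum_basisEmb (x : Fock d ℂ →L[ℂ] Fock d ℂ) (W : Finset (Word d))
    (c e : W → ℂ) :
    ⟪∑ α, basisEmb ℂ α.1 (c α), x (∑ β, basisEmb ℂ β.1 (e β))⟫_ℂ =
      ∑ α, ∑ β, conj (c α) * matCoeff α.1 β.1 x * e β := by
  rw [map_sum, sum_inner]
  refine Finset.sum_congr rfl fun α _ => ?_
  rw [inner_sum]
  refine Finset.sum_congr rfl fun β _ => ?_
  have h : basisEmb ℂ β.1 (e β) = e β • basisEmb ℂ β.1 1 := by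
    rw [← map_smul, smul_eq_mul, mul_one]
  rw [h, map_smul, inner_smul_right, inner_basisEmb, RCLike.inner_apply]
  change e β * (matCoeff α.1 β.1 x * conj (c α)) = _
  ring

variable [CompleteSpace K]

/-- The map `x ↦ ∑_{α, β ∈ W} ⟨e_α, x e_β⟩ V^α R^* R (V^β)^*`. -/
def truncMap (V : Fin d → K →L[ℂ] K) (R : K →L[ℂ] K) (W : Finset (Word d)) :
    (Fock d ℂ →L[ℂ] Fock d ℂ) →ₗ[ℂ] (K →L[ℂ] K) :=
  ∑ α ∈ W, ∑ β ∈ W,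
    (matCoeff α β).smulRight (wordOp V α * (star R * R) * star (wordOp V β))

theorem truncMap_apply (V : Fin d → K →L[ℂ] K) (R : K →L[ℂ] K) (W : Finset (Word d))
    (x : Fock d ℂ →L[ℂ] Fock d ℂ) :
    truncMap V R W x = ∑ α ∈ W, ∑ β ∈ W,
      matCoeff α β x • (wordOp V α * (star R * R) * star (wordOp V β)) := by
  simp [truncMap]

theorem inner_truncMap (V : Fin d → K →L[ℂ] K) (R : K →L[ℂ] K) (W : Finset (Word d))
    (x : Fock d ℂ →L[ℂ] Fock d ℂ) (g h : K) :
    ⟪g, truncMap V R W x h⟫_ℂ = ∑ α : W, ∑ β : W, matCoeff α.1 β.1 x *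
      ⟪R (star (wordOp V α.1) g), R (star (wordOp V β.1) h)⟫_ℂ := by
  rw [truncMap_apply, ← Finset.sum_coe_sort]
  simp only [← Finset.sum_coe_sort W, _root_.sum_apply, inner_sum, smul_apply,
    inner_smul_right]
  refine Finset.sum_congr rfl fun α _ => Finset.sum_congr rfl fun β _ => ?_
  congr 1
  change ⟪g, wordOp V α.1 (star R (R (star (wordOp V β.1) h)))⟫_ℂ = _
  rw [ContinuousLinearMap.star_eq_adjoint R, ContinuousLinearMap.star_eq_adjoint (wordOp V α.1),
    ← ContinuousLinearMap.adjoint_inner_left, ContinuousLinearMap.adjoint_inner_right]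

/-- Testing `x` on vectors supported in `W` gives a positive scalar matrix indexed by pairs `(i,
α)`. The form is its Schur product with the Gram matrix of the vectors `R (V^α)^* h_i`. -/
theorem truncMap_nonneg (V : Fin d → K →L[ℂ] K) (R : K →L[ℂ] K) (W : Finset (Word d)) {n : ℕ}
    (x : Fin n → Fin n → Fock d ℂ →L[ℂ] Fock d ℂ)
    (hx : ∀ v : Fin n → Fock d ℂ, 0 ≤ ∑ i, ∑ j, ⟪v i, x i j (v j)⟫_ℂ) (h : Fin n → K) :
    0 ≤ ∑ i, ∑ j, ⟪h i, truncMap V R W (x i j) (h j)⟫_ℂ := by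
  have key := sum_mul_inner_nonneg (ι := Fin n × W)
    (fun p q => matCoeff p.2.1 q.2.1 (x p.1 q.1)) (fun c => ?_)
    (fun p => R (star (wordOp V p.2.1) (h p.1)))
  · simp only [Fintype.sum_prod_type] at key
    refine key.trans_eq (Finset.sum_congr rfl fun i _ => ?_)
    rw [Finset.sum_comm]
    refine Finset.sum_congr rfl fun j _ => ?_
    rw [inner_truncMap]
  · have := hx fun i => ∑ α : W, basisEmb ℂ α.1 (c (i, α))
    simp only [inner_sum_basisEmb (W := W)] at this
    simp only [Fintype.sum_prod_type]
    refine this.trans_eq (Finset.sum_congr rfl fun i _ => ?_)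
    rw [Finset.sum_comm]

/-- `∑_{|β| ≤ n} V^β X (V^β)^*`. -/
def conjSum (V : Fin d → K →L[ℂ] K) (X : K →L[ℂ] K) (n : ℕ) : K →L[ℂ] K :=
  ∑ β ∈ wordsLE d n, wordOp V β * X * star (wordOp V β)

theorem conjSum_zero (V : Fin d → K →L[ℂ] K) (X : K →L[ℂ] K) : conjSum V X 0 = X := by
  simp [conjSum, wordsLE, wordOp_nil]

theorem conjSum_succ (V : Fin d → K →L[ℂ] K) (X : K →L[ℂ] K) (n : ℕ) :
    conjSum V X (n + 1) = X + ∑ j, V j * conjSum V X n * star (V j) := by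
  rw [conjSum, sum_wordsLE_succ]
  simp only [wordOp_nil, star_one, mul_one, one_mul, wordOp_cons, star_mul, conjSum,
    Finset.mul_sum, Finset.sum_mul, mul_assoc]

/-- The defect telescopes: `∑_{s < n} ∑_{|β| ≤ s} V^β P V^{β*} + ∑_{|β| ≤ n} V^β V^{β*} = n + 1`
for `P = 1 - ∑_j V_j V_j^*`. -/
theorem sum_conjSum_add (V : Fin d → K →L[ℂ] K) (n : ℕ) :
    ∑ s ∈ Finset.range n, conjSum V (1 - ∑ j, V j * star (V j)) s + conjSum V 1 n =
      ((n + 1 : ℕ) : ℂ) • 1 := by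
  induction n with
  | zero => simp [conjSum_zero]
  | succ n ih =>
    -- Conjugate the induction hypothesis by each `V j` and sum. The empty word then contributes `n
    -- + 1` copies of the defect and one identity, for a total of `n + 2`.
    have h : ∑ j, V j * (∑ s ∈ Finset.range n, conjSum V (1 - ∑ j, V j * star (V j)) s +
        conjSum V 1 n) * star (V j) = ((n + 1 : ℕ) : ℂ) • ∑ j, V j * star (V j) := by
      rw [ih, Finset.smul_sum]
      refine Finset.sum_congr rfl fun j _ => ?_
      rw [mul_smul_comm, mul_one, smul_mul_assoc]
    simp only [mul_add, add_mul, Finset.sum_add_distrib, Finset.mul_sum, Finset.sum_mul] at h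
    rw [Finset.sum_comm] at h
    rw [Finset.sum_range_succ', conjSum_zero, conjSum_succ]
    simp only [conjSum_succ, Finset.sum_add_distrib, Finset.sum_const, Finset.card_range]
    rw [← Nat.cast_smul_eq_nsmul ℂ n]
    rw [← eq_sub_iff_add_eq] at h
    rw [h]
    push_cast
    module

/-- As `L^γ e_β = e_{γβ}`, only the pairs `(γβ, β)` survive, and the truncation restricts `β` to
length at most `n - |γ|`. -/
theorem truncMap_shiftWord (V : Fin d → K →L[ℂ] K) (R : K →L[ℂ] K) (γ : Word d) (n : ℕ) :
    truncMap V R (wordsLE d n) (shiftWord γ).1 =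
      if γ.length ≤ n then wordOp V γ * conjSum V (star R * R) (n - γ.length) else 0 := by
  rw [truncMap_apply, Finset.sum_comm]
  have e : ∀ β ∈ wordsLE d n, (∑ α ∈ wordsLE d n, matCoeff α β (shiftWord γ).1 •
      (wordOp V α * (star R * R) * star (wordOp V β))) =
      if γ.length + β.length ≤ n then
        wordOp V γ * (wordOp V β * (star R * R) * star (wordOp V β)) else 0 := by
    intro β _
    simp only [matCoeff_shiftWord, ite_smul, one_smul, zero_smul]
    rw [Finset.sum_ite_eq']
    simp only [mem_wordsLE, List.length_append, wordOp_append, mul_assoc]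
  rw [Finset.sum_congr rfl e]
  split_ifs with h
  · rw [conjSum, Finset.mul_sum, ← Finset.sum_filter]
    refine Finset.sum_congr ?_ fun _ _ => rfl
    ext β
    simp only [Finset.mem_filter, mem_wordsLE]
    omega
  · exact Finset.sum_eq_zero fun β _ => if_neg (by omega)

/-- The `V_j V_j^*` are mutually orthogonal projections, so the defect is a projection and can serve
as `R` with `R^* R` equal to itself. -/
theorem star_defect_mul_defect {V : Fin d → K →L[ℂ] K}
    (hV : ∀ i j, star (V i) * V j = if i = j then 1 else 0) :
    star (1 - ∑ j, V j * star (V j)) * (1 - ∑ j, V j * star (V j)) =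
      1 - ∑ j, V j * star (V j) := by
  have h1 : star (∑ j, V j * star (V j)) = ∑ j, V j * star (V j) := by
    simp [star_sum]
  have h2 : (∑ j, V j * star (V j)) * (∑ j, V j * star (V j)) = ∑ j, V j * star (V j) := by
    rw [Finset.sum_mul_sum]
    refine Finset.sum_congr rfl fun i _ => ?_
    have : ∀ j, V i * star (V i) * (V j * star (V j)) =
        if i = j then V i * star (V i) else 0 := by
      intro j
      rw [mul_assoc, ← mul_assoc (star (V i)), hV]
      split_ifs with h
      · rw [one_mul, h]
      · rw [zero_mul, mul_zero]
    rw [Finset.sum_congr rfl fun j _ => this j]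
    simp
  rw [star_sub, star_one, h1, sub_mul, one_mul, mul_sub, h2, mul_one, sub_self, sub_zero]

/-- Fejér means of the functional calculus `L^α ↦ V^α` of a row isometry. -/
def fejer (V : Fin d → K →L[ℂ] K) (n : ℕ) : FreeCPMap d K where
  -- The defect truncations alone do not suffice, since the defect may even vanish. The single term
  -- with `R = 1` at level `n` supplies the remainder that makes `sum_conjSum_add` telescope.
  toLinearMap := ((((n + 1 : ℕ) : ℝ)⁻¹ : ℝ) : ℂ) •
    ((∑ t ∈ Finset.range n, truncMap V (1 - ∑ j, V j * star (V j)) (wordsLE d t)) +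
      truncMap V 1 (wordsLE d n)) ∘ₗ (diskSystem d).subtype
  completelyPositive m x hx h := by
    have hn : (0 : ℂ) ≤ ((((n + 1 : ℕ) : ℝ)⁻¹ : ℝ) : ℂ) := by
      rw [Complex.zero_le_real]; positivity
    have e : ∀ i j, ⟪h i, (((((n + 1 : ℕ) : ℝ)⁻¹ : ℝ) : ℂ) •
        ((∑ t ∈ Finset.range n, truncMap V (1 - ∑ j, V j * star (V j)) (wordsLE d t)) +
          truncMap V 1 (wordsLE d n)) ∘ₗ (diskSystem d).subtype) (x i j) (h j)⟫_ℂ =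
        ((((n + 1 : ℕ) : ℝ)⁻¹ : ℝ) : ℂ) * (∑ t ∈ Finset.range n,
          ⟪h i, truncMap V (1 - ∑ j, V j * star (V j)) (wordsLE d t) (x i j).1 (h j)⟫_ℂ +
            ⟪h i, truncMap V 1 (wordsLE d n) (x i j).1 (h j)⟫_ℂ) := by
      intro i j
      simp only [LinearMap.smul_apply, LinearMap.comp_apply, LinearMap.add_apply,
        LinearMap.sum_apply, smul_apply, add_apply, _root_.sum_apply, inner_smul_right,
        inner_add_right, inner_sum]
      rfl
    simp only [e]
    simp only [← Finset.mul_sum, Finset.sum_add_distrib]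
    refine mul_nonneg hn (add_nonneg ?_ (truncMap_nonneg V 1 _ (fun i j => (x i j).1) hx h))
    have e2 : ∑ i, ∑ j, ∑ t ∈ Finset.range n,
        ⟪h i, truncMap V (1 - ∑ j, V j * star (V j)) (wordsLE d t) (x i j).1 (h j)⟫_ℂ =
        ∑ t ∈ Finset.range n, ∑ i, ∑ j,
          ⟪h i, truncMap V (1 - ∑ j, V j * star (V j)) (wordsLE d t) (x i j).1 (h j)⟫_ℂ := by
      rw [Finset.sum_comm]
      refine Finset.sum_comm.trans ?_
      simp only [Finset.sum_comm (s := Finset.univ) (t := Finset.range n)]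
    rw [e2]
    exact Finset.sum_nonneg fun t _ => truncMap_nonneg V _ _ (fun i j => (x i j).1) hx h

theorem fejer_shiftWord {V : Fin d → K →L[ℂ] K}
    (hV : ∀ i j, star (V i) * V j = if i = j then 1 else 0) {n : ℕ} {γ : Word d}
    (hn : γ.length ≤ n) :
    (fejer V n).toLinearMap (toSystem (shiftWord γ)) =
      (((n - γ.length + 1 : ℕ) : ℂ) / ((n + 1 : ℕ) : ℂ)) • wordOp V γ := by
  obtain ⟨m, rfl⟩ := Nat.exists_eq_add_of_le hn
  have e : (fejer V (γ.length + m)).toLinearMap (toSystem (shiftWord γ)) =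
      ((((γ.length + m + 1 : ℕ) : ℝ)⁻¹ : ℝ) : ℂ) • (∑ t ∈ Finset.range (γ.length + m),
        truncMap V (1 - ∑ j, V j * star (V j)) (wordsLE d t) (shiftWord γ).1 +
          truncMap V 1 (wordsLE d (γ.length + m)) (shiftWord γ).1) := by
    simp only [fejer, LinearMap.smul_apply, LinearMap.comp_apply, LinearMap.add_apply,
      LinearMap.sum_apply]
    rfl
  -- Levels below `|γ|` contribute nothing; re-indexing the others from `|γ|` leaves the telescoping
  -- sum with `n - |γ|` in place of `n`.
  rw [e, truncMap_shiftWord, if_pos hn, star_one, one_mul, Finset.sum_range_add,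
    Finset.sum_eq_zero (s := Finset.range γ.length), zero_add]
  · simp only [truncMap_shiftWord, le_add_iff_nonneg_right, zero_le, if_true, add_tsub_cancel_left,
      star_defect_mul_defect hV]
    rw [← Finset.mul_sum, ← mul_add, sum_conjSum_add, mul_smul_comm, mul_one, smul_smul]
    congr 1
    push_cast
    ring
  · intro t ht
    rw [Finset.mem_range] at ht
    rw [truncMap_shiftWord, if_neg (by omega)]

/-- The functional calculus of a row isometry: `L^α ↦ V^α` is completely positive. -/
theorem exists_rowIsometry_cpMap {V : Fin d → K →L[ℂ] K}
    (hV : ∀ i j, star (V i) * V j = if i = j then 1 else 0) :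
    ∃ ν : FreeCPMap d K, ∀ α, ν.toLinearMap (toSystem (shiftWord α)) = wordOp V α := by
  refine FreeCPMap.exists_limit (fejer V) (C := 1) (fun n => ?_) _ fun γ => ?_
  · rw [← shiftWord_nil, fejer_shiftWord hV (Nat.zero_le n), wordOp_nil, List.length_nil,
      Nat.sub_zero, div_self (Nat.cast_ne_zero.2 n.succ_ne_zero), one_smul]
    exact ContinuousLinearMap.norm_id_le
  · have h1 : Tendsto (fun n : ℕ => ((n - γ.length + 1 : ℕ) : ℂ) / ((n + 1 : ℕ) : ℂ))
        atTop (𝓝 1) := by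
      rw [← tendsto_add_atTop_iff_nat γ.length]
      have h2 := tendsto_add_mul_div_add_mul_atTop_nhds (1 : ℂ) (γ.length + 1) 1 one_ne_zero
      rw [div_one] at h2
      refine h2.congr fun n => ?_
      rw [Nat.add_sub_cancel]
      push_cast
      congr 1 <;> ring
    have h3 := h1.smul_const (wordOp V γ)
    rw [one_smul] at h3
    refine h3.congr' ?_
    filter_upwards [eventually_ge_atTop γ.length] with n hn
    rw [fejer_shiftWord hV hn]

end Fejer

/-! ### The free Hardy space and its row isometry -/

namespace FreeCPMap

variable {d : ℕ} {H : Type*} [NormedAddCommGroup H] [InnerProductSpace ℂ H] (μ : FreeCPMap d H)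

/-- The map `a ↦ a ⊗ h` into `F²(μ)`, as a linear map. -/
def toHardyₗ (h : H) : diskAlgebra d →ₗ[ℂ] μ.FreeHardy :=
  (UniformSpace.Completion.toComplL (𝕜 := ℂ) (E := μ.GNSPre)).toLinearMap ∘ₗ
    (show diskAlgebra d →ₗ[ℂ] μ.GNSPre from (TensorProduct.mk ℂ (diskAlgebra d) H).flip h)

theorem toHardyₗ_apply (a : diskAlgebra d) (h : H) : μ.toHardyₗ h a = μ.toHardy a h := rfl

theorem norm_toHardyₗ_le (a : diskAlgebra d) (h : H) :
    ‖μ.toHardyₗ h a‖ ≤ ‖a.1‖ * ‖μ.toHardyₗ h 1‖ := by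
  have e : μ.toHardyₗ h a = μ.gnsRep a (μ.toHardyₗ h 1) := by
    rw [toHardyₗ_apply, toHardyₗ_apply, gnsRep_toHardy, mul_one]
  rw [e, toHardyₗ_apply, toHardy, gnsRep, ContinuousLinearMap.completion_apply_coe,
    UniformSpace.Completion.norm_coe, UniformSpace.Completion.norm_coe]
  exact μ.norm_gnsMul_le a _

/-- For fixed `h` the map `a ↦ a ⊗ h` is bounded, so polynomial approximation in the disk algebra
carries over to the Hardy space; finite tensor sums are dense in the completion. -/
theorem toHardy_total : (Submodule.span ℂ (Set.range fun p : Word d × H =>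
    μ.toHardy (shiftWord p.1) p.2)).topologicalClosure = ⊤ := by
  set S := Submodule.span ℂ (Set.range fun p : Word d × H =>
    μ.toHardy (shiftWord p.1) p.2) with hS
  have hpoly : ∀ h, ∀ a ∈ polyAlgebra d, ∀ ha : a ∈ diskAlgebra d,
      μ.toHardyₗ h ⟨a, ha⟩ ∈ S := by
    intro h a hp
    rw [← Subalgebra.mem_toSubmodule, polyAlgebra_eq_span] at hp
    induction hp using Submodule.span_induction with
    | mem x hx =>
      intro hx'
      obtain ⟨α, rfl⟩ := hx
      exact Submodule.subset_span ⟨(α, h), rfl⟩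
    | zero =>
      intro h0
      have : (⟨0, h0⟩ : diskAlgebra d) = 0 := rfl
      rw [this, map_zero]
      exact zero_mem _
    | add x y hx hy ihx ihy =>
      intro hxy
      rw [← polyAlgebra_eq_span, Subalgebra.mem_toSubmodule] at hx hy
      have : (⟨x + y, hxy⟩ : diskAlgebra d) =
        ⟨x, polyAlgebra_le hx⟩ + ⟨y, polyAlgebra_le hy⟩ := rfl
      rw [this, map_add]
      exact add_mem (ihx _) (ihy _)
    | smul c x hx ih =>
      intro hcx
      rw [← polyAlgebra_eq_span, Subalgebra.mem_toSubmodule] at hx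
      have : (⟨c • x, hcx⟩ : diskAlgebra d) = c • ⟨x, polyAlgebra_le hx⟩ := rfl
      rw [this, map_smul]
      exact S.smul_mem _ (ih _)
  have hdisk : ∀ (a : diskAlgebra d) (h : H), μ.toHardyₗ h a ∈ S.topologicalClosure := by
    intro a h
    have ha : a.1 ∈ closure (polyAlgebra d : Set (Fock d ℂ →L[ℂ] Fock d ℂ)) := by
      rw [← Subalgebra.topologicalClosure_coe]; exact a.2
    obtain ⟨x, hx, hxa⟩ := mem_closure_iff_seq_limit.1 ha
    refine mem_closure_of_tendsto (f := fun n => μ.toHardyₗ h ⟨x n, polyAlgebra_le (hx n)⟩)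
      (b := atTop) ?_ (Eventually.of_forall fun n => hpoly h _ (hx n) _)
    rw [tendsto_iff_norm_sub_tendsto_zero] at hxa ⊢
    refine squeeze_zero (fun _ => norm_nonneg _) (fun n => ?_)
      (by simpa using hxa.mul_const ‖μ.toHardyₗ h 1‖)
    rw [← map_sub]
    exact μ.norm_toHardyₗ_le _ _
  rw [eq_top_iff]
  rintro x -
  induction x using UniformSpace.Completion.induction_on with
  | hp => exact S.isClosed_topologicalClosure
  | ih x =>
    obtain ⟨n, a, h, hx⟩ := TensorProduct.exists_sum_tmul_eq (R := ℂ) x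
    have e : (x : μ.FreeHardy) = ∑ i, μ.toHardyₗ (h i) (a i) := by
      subst hx
      exact map_sum (UniformSpace.Completion.toComplL (𝕜 := ℂ) (E := μ.GNSPre))
        (fun i => (show μ.GNSPre from a i ⊗ₜ[ℂ] h i)) Finset.univ
    rw [e]
    exact Submodule.sum_mem _ fun i _ => hdisk _ _

/-- The relation `L_i^* L_j = δ_{ij}` collapses the middle of `(L_i a)^* (L_j b)` before `μ` is
applied. -/
theorem inner_toHardy_shift_mul (i j : Fin d) (a b : diskAlgebra d) (g h : H) :
    ⟪μ.toHardy (shiftWord [i] * a) g, μ.toHardy (shiftWord [j] * b) h⟫_ℂ =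
      if i = j then ⟪μ.toHardy a g, μ.toHardy b h⟫_ℂ else 0 := by
  rw [inner_toHardy, inner_toHardy]
  have e : (starMul (shiftWord [i] * a) (shiftWord [j] * b)).1 =
      star a.1 * (star (leftCreation ℂ i) * leftCreation ℂ j) * b.1 := by
    change star ((shiftWord [i]).1 * a.1) * ((shiftWord [j]).1 * b.1) = _
    rw [shiftWord_singleton_coe, shiftWord_singleton_coe, star_mul]
    simp only [mul_assoc]
  rw [star_leftCreation_mul] at e
  split_ifs with h
  · rw [if_pos h, mul_one] at e
    rw [show starMul (shiftWord [i] * a) (shiftWord [j] * b) = starMul a b from Subtype.ext e]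
  · rw [if_neg h, mul_zero, zero_mul] at e
    rw [show starMul (shiftWord [i] * a) (shiftWord [j] * b) = 0 from Subtype.ext e, map_zero,
      zero_apply, inner_zero_right]

theorem adjoint_gnsRep_comp_gnsRep (i j : Fin d) :
    (μ.gnsRep (shiftWord [i])).adjoint ∘L μ.gnsRep (shiftWord [j]) = if i = j then 1 else 0 := by
  refine eq_of_eqOn_total μ.toHardy_total fun p => ext_inner_total μ.toHardy_total fun q => ?_
  rw [ContinuousLinearMap.comp_apply, ContinuousLinearMap.adjoint_inner_right, gnsRep_toHardy,
    gnsRep_toHardy, inner_toHardy_shift_mul]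
  split_ifs
  · rfl
  · simp

theorem adjoint_rowShift_apply (x : μ.FreeHardy) (j : Fin d) :
    (rowShift μ).adjoint x j = (μ.gnsRep (shiftWord [j])).adjoint x := by
  refine ext_inner_left ℂ fun y => ?_
  have e : rowShift μ (WithLp.toLp 2 (Pi.single j y)) = μ.gnsRep (shiftWord [j]) y := by
    rw [rowShift, _root_.sum_apply, Finset.sum_eq_single j]
    · simp
    · intro i _ hij
      simp [hij]
    · simp
  have e2 : ⟪WithLp.toLp 2 (Pi.single j y), (rowShift μ).adjoint x⟫_ℂ =
      ⟪y, (rowShift μ).adjoint x j⟫_ℂ := by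
    rw [PiLp.inner_apply, Finset.sum_eq_single j]
    · simp
    · intro i _ hij
      simp [hij]
    · simp
  rw [← e2, ContinuousLinearMap.adjoint_inner_right, e, ContinuousLinearMap.adjoint_inner_right]

theorem adjoint_rowShift_comp_rowShift : (rowShift μ).adjoint ∘L rowShift μ = 1 := by
  ext1 u
  ext j : 1
  rw [ContinuousLinearMap.comp_apply, adjoint_rowShift_apply, rowShift, _root_.sum_apply, map_sum,
    Finset.sum_eq_single j]
  · have := congrArg (fun T => T (u j)) (μ.adjoint_gnsRep_comp_gnsRep j j)
    simpa using this
  · intro i _ hij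
    have := congrArg (fun T => T (u i)) (μ.adjoint_gnsRep_comp_gnsRep j i)
    simpa [hij.symm] using this
  · simp

end FreeCPMap

/-! ### Aleksandrov–Clark map, Cauchy transform and Clark intertwining -/

namespace SchurPair

variable {d : ℕ} {H : Type*} [NormedAddCommGroup H] [InnerProductSpace ℂ H] [CompleteSpace H]
  (B : SchurPair d H)

/-- Recasts the Clark normalisation as the `∅` row of the Herglotz kernel; the transpose in the
normalisation cancels the one relating `H^L` to `H^R`. -/
theorem isAleksandrovClark_iff (μ : FreeCPMap d H) :
    IsAleksandrovClark B μ ↔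
      ∀ α, μ.toLinearMap (toSystem (shiftWord α)) = B.herglotzKernel [] α := by
  have h0 : B.herglotzKernel [] [] =
      (1 / 2 : ℂ) • (B.herglotzLeft [] + star (B.herglotzLeft [])) := by
    rw [herglotzKernel_nil_nil, herglotzRight_apply]
    rfl
  have h1 : ∀ α : Word d, α ≠ [] →
      star (B.herglotzKernel [] α) = (1 / 2 : ℂ) • B.herglotzLeft α.reverse := by
    intro α hα
    rw [B.herglotzKernel_nil_left hα, herglotzRight_apply, star_smul, star_star]
    simp
  constructor
  · rintro ⟨ha, hb⟩ α
    by_cases hα : α = []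
    · subst hα
      rw [shiftWord_nil, ha, h0]
    · refine star_injective ?_
      have := hb α.reverse (by simpa using hα)
      rw [List.reverse_reverse] at this
      rw [this, h1 α hα]
  · intro h
    refine ⟨?_, fun α hα => ?_⟩
    · rw [← shiftWord_nil, h, h0]
    · rw [h, h1 _ (by simpa using hα), List.reverse_reverse]

section Kernel

variable {K : Type*} [NormedAddCommGroup K] [InnerProductSpace ℂ K] [CompleteSpace K]
  [RKHS ℂ K (Word d) H]

theorem exists_isAleksandrovClark (hK : RKHS.kernel K = B.herglotzKernel) :
    ∃ μ : FreeCPMap d H, IsAleksandrovClark B μ := by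
  obtain ⟨V, hV, hVV⟩ := B.exists_herglotzShift hK
  obtain ⟨ν, hν⟩ := exists_rowIsometry_cpMap hVV
  have hw : ∀ (α : Word d) (h : H),
      wordOp V α (RKHS.kerFun K [] h) = RKHS.kerFun K α h := by
    intro α h
    induction α with
    | nil => rfl
    | cons j α ih =>
      rw [wordOp_cons]
      change V j (wordOp V α _) = _
      rw [ih, hV]
  -- Because `V^α K_∅ = K_α`, the compression takes `L^α` to `K_∅^* K_α`, the kernel entry at `(∅,
  -- α)`.
  refine ⟨ν.compress (RKHS.kerFun K []), (B.isAleksandrovClark_iff _).2 fun α => ?_⟩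
  ext h
  rw [FreeCPMap.compress_apply, hν, ContinuousLinearMap.comp_apply,
    ContinuousLinearMap.comp_apply, hw, RKHS.adjoint_kerFun, RKHS.kerFun_apply, hK]

/-- Both Gram matrices obey the same first-letter recursion, so it suffices to compare entries with
one empty word, where this is the Clark normalisation. -/
theorem inner_toHardy_shiftWord (hK : RKHS.kernel K = B.herglotzKernel) {μ : FreeCPMap d H}
    (hμ : IsAleksandrovClark B μ) (α β : Word d) (g h : H) :
    ⟪RKHS.kerFun K α g, RKHS.kerFun K β h⟫_ℂ =
      ⟪μ.toHardy (shiftWord α) g, μ.toHardy (shiftWord β) h⟫_ℂ := by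
  have h0 : ∀ (β : Word d) (g h : H), ⟪RKHS.kerFun K [] g, RKHS.kerFun K β h⟫_ℂ =
      ⟪μ.toHardy (shiftWord []) g, μ.toHardy (shiftWord β) h⟫_ℂ := by
    intro β g h
    rw [B.inner_kerFun_herglotz hK, FreeCPMap.inner_toHardy,
      ← (B.isAleksandrovClark_iff μ).1 hμ β]
    have : FreeCPMap.starMul (shiftWord []) (shiftWord β) = toSystem (shiftWord β) := by
      refine Subtype.ext ?_
      change star (1 : Fock d ℂ →L[ℂ] Fock d ℂ) * (shiftWord β).1 = _
      rw [star_one, one_mul]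
      rfl
    rw [this]
  induction α generalizing β with
  | nil => exact h0 β g h
  | cons i α ih =>
    cases β with
    | nil => rw [← inner_conj_symm, h0, inner_conj_symm]
    | cons j β =>
      rw [shiftWord_cons i, shiftWord_cons j, FreeCPMap.inner_toHardy_shift_mul, ← ih,
        B.inner_kerFun_herglotz hK, B.inner_kerFun_herglotz hK]
      split_ifs with hij
      · subst hij
        rw [herglotzKernel_cons]
      · rw [B.herglotzKernel_cons_of_ne hij]
        simp

theorem exists_cauchyTransform (hK : RKHS.kernel K = B.herglotzKernel) {μ : FreeCPMap d H}
    (hμ : IsAleksandrovClark B μ) :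
    ∃ C : μ.FreeHardy ≃ₗᵢ[ℂ] K, ∀ (α : Word d) (h : H),
      C (μ.gnsRep (shiftWord α) (μ.toHardy 1 h)) = RKHS.kerFun K α h := by
  obtain ⟨C, hC⟩ := exists_linearIsometryEquiv_of_inner_eq μ.toHardy_total
    (kerFun_total (K := K)) fun p q => B.inner_toHardy_shiftWord hK hμ p.1 q.1 p.2 q.2
  refine ⟨C, fun α h => ?_⟩
  rw [FreeCPMap.gnsRep_toHardy, mul_one]
  exact hC (α, h)

theorem cauchyTransform_unique {μ : FreeCPMap d H} {C C' : μ.FreeHardy ≃ₗᵢ[ℂ] K}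
    (hC : ∀ (α : Word d) (h : H),
      C (μ.gnsRep (shiftWord α) (μ.toHardy 1 h)) = RKHS.kerFun K α h)
    (hC' : ∀ (α : Word d) (h : H),
      C' (μ.gnsRep (shiftWord α) (μ.toHardy 1 h)) = RKHS.kerFun K α h) : C = C' := by
  have key : (C.toContinuousLinearEquiv : μ.FreeHardy →L[ℂ] K) =
      (C'.toContinuousLinearEquiv : μ.FreeHardy →L[ℂ] K) := by
    refine eq_of_eqOn_total μ.toHardy_total fun p => ?_
    have h1 := hC p.1 p.2
    have h2 := hC' p.1 p.2
    rw [FreeCPMap.gnsRep_toHardy, mul_one] at h1 h2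
    exact h1.trans h2.symm
  ext x : 1
  exact congrArg (fun T => T x) key

/-- The Cauchy transform turns `π(L_j)` into `K_α h ↦ K_{jα} h`, whose adjoint deletes an initial
letter `j` from the coefficient index. -/
theorem cauchyTransform_adjoint_gnsRep {μ : FreeCPMap d H} {C : μ.FreeHardy ≃ₗᵢ[ℂ] K}
    (hC : ∀ (α : Word d) (h : H),
      C (μ.gnsRep (shiftWord α) (μ.toHardy 1 h)) = RKHS.kerFun K α h)
    (j : Fin d) (f : K) (α : Word d) :
    C ((μ.gnsRep (shiftWord [j])).adjoint (C.symm f)) α = f (j :: α) := by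
  refine ext_inner_left ℂ fun h => ?_
  rw [← RKHS.kerFun_inner, ← RKHS.kerFun_inner, ← hC α h, C.inner_map_map,
    ContinuousLinearMap.adjoint_inner_right, FreeCPMap.gnsRep_toHardy, FreeCPMap.gnsRep_toHardy,
    ← hC (j :: α), ← C.inner_map_map, C.apply_symm_apply, FreeCPMap.gnsRep_toHardy,
    shiftWord_cons j α, mul_assoc]

/-- The Clark intertwining formula on coefficients. -/
theorem clark_apply {D : Type*} [NormedAddCommGroup D] [InnerProductSpace ℂ D]
    [RKHS ℂ D (Word d) H] {μ : FreeCPMap d H} {C : μ.FreeHardy ≃ₗᵢ[ℂ] K} {M : K ≃ₗᵢ[ℂ] D}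
    (hC : ∀ (α : Word d) (h : H),
      C (μ.gnsRep (shiftWord α) (μ.toHardy 1 h)) = RKHS.kerFun K α h)
    (hM : ∀ f : K, ⇑(M f) = rightMulVec (oneSeries d H - B.right) f)
    (F : D) (j : Fin d) (γ : Word d) :
    (C.trans M) ((μ.gnsRep (shiftWord [j])).adjoint ((C.trans M).symm F)) γ =
      F (j :: γ) + B.right (j :: γ) (Ring.inverse (1 - B.right []) (F [])) := by
  obtain ⟨f, rfl⟩ := M.surjective F
  have h1 : (C.trans M).symm (M f) = C.symm f := by
    rw [LinearIsometryEquiv.symm_trans, LinearIsometryEquiv.trans_apply, M.symm_apply_apply]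
  -- The constant term of `(I - B^R) •_R f` is `(I - B_∅) f_∅`; this is where `(I - B_∅)⁻¹` enters
  -- the formula.
  have h2 : Ring.inverse (1 - B.right []) ((M f) []) = f [] := by
    have : (M f) [] = (1 - B.right []) (f []) := by
      rw [hM]
      simp [rightMulVec, oneSeries]
    rw [this]
    exact congrArg (fun T => T (f [])) (Ring.inverse_mul_cancel _ B.isUnit)
  have h3 : ⇑(C ((μ.gnsRep (shiftWord [j])).adjoint (C.symm f))) = fun α => f (j :: α) :=
    funext (cauchyTransform_adjoint_gnsRep hC j f)
  -- The coefficient of `I - B^R` at a nonempty word is `-B_{jγ}`, so the boundary term of the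
  -- product rule cancels the perturbation.
  rw [h1, h2, LinearIsometryEquiv.trans_apply, hM, hM, rightMulVec_cons, h3]
  simp [oneSeries]

end Kernel

theorem clarkOp_apply (μ : FreeCPMap d H) (ℱ : μ.FreeHardy ≃ₗᵢ[ℂ] B.DBR) (F : B.DBR)
    (j : Fin d) :
    B.clarkOp μ ℱ F j = ℱ ((μ.gnsRep (shiftWord [j])).adjoint (ℱ.symm F)) := by
  rw [← FreeCPMap.adjoint_rowShift_apply]
  have : (ℱ.toContinuousLinearEquiv : μ.FreeHardy →L[ℂ] B.DBR).adjoint F = ℱ.symm F := by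
    refine ext_inner_left ℂ fun y => ?_
    rw [ContinuousLinearMap.adjoint_inner_right, ← ℱ.inner_map_map y, ℱ.apply_symm_apply]
    rfl
  rw [← this]
  rfl

theorem clarkOp_eq {μ : FreeCPMap d H} {ℱ : μ.FreeHardy ≃ₗᵢ[ℂ] B.DBR}
    (hℱ : B.IsWeightedCauchyTransform μ ℱ) :
    B.clarkOp μ ℱ = B.dbrShift + B.gleason ∘L Ring.inverse (1 - B.right []) ∘L
      (RKHS.kerFun B.DBR []).adjoint := by
  obtain ⟨C, M, hC, hM, rfl⟩ := hℱ
  ext1 F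
  ext j : 1
  refine RKHS.ext fun γ => ?_
  rw [clarkOp_apply, B.clark_apply hC hM F j γ, add_apply, PiLp.add_apply, RKHS.coe_add,
    Pi.add_apply, dbrShift_apply, ContinuousLinearMap.comp_apply, ContinuousLinearMap.comp_apply,
    gleason_apply, RKHS.adjoint_kerFun]

theorem existsUnique_weightedCauchyTransform {μ : FreeCPMap d H} (hμ : IsAleksandrovClark B μ) :
    ∃! ℱ : μ.FreeHardy ≃ₗᵢ[ℂ] B.DBR, B.IsWeightedCauchyTransform μ ℱ := by
  obtain ⟨C, hC⟩ := B.exists_cauchyTransform (K := B.HerglotzSpace)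
    RKHS.OfKernel.kernel_ofKernel hμ
  obtain ⟨M, hM⟩ := B.exists_mulOneSub (K := B.HerglotzSpace) (D := B.DBR)
    RKHS.OfKernel.kernel_ofKernel RKHS.OfKernel.kernel_ofKernel
  refine ⟨C.trans M, ⟨C, M, hC, hM, rfl⟩, ?_⟩
  rintro _ ⟨C', M', hC', hM', rfl⟩
  have h1 : C' = C := cauchyTransform_unique hC' hC
  have h2 : M' = M := by
    ext f : 1
    exact DFunLike.coe_injective ((hM' f).trans (hM f).symm)
  rw [h1, h2]

theorem existsUnique_isAleksandrovClark : ∃! μ : FreeCPMap d H, IsAleksandrovClark B μ := by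
  obtain ⟨μ, hμ⟩ := B.exists_isAleksandrovClark (K := B.HerglotzSpace)
    RKHS.OfKernel.kernel_ofKernel
  refine ⟨μ, hμ, fun ν hν => FreeCPMap.ext_shiftWord fun α => ?_⟩
  rw [(B.isAleksandrovClark_iff ν).1 hν, (B.isAleksandrovClark_iff μ).1 hμ]

end SchurPair

end FreeClark

end

theorem mainTheorem2 {d : ℕ} {H : Type*} [NormedAddCommGroup H] [InnerProductSpace ℂ H]
    [CompleteSpace H] (B : FreeClark.SchurPair d H) :
    ∃ (ι : B.DBR →L[ℂ] FreeClark.Fock d H)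
      (X : B.DBR →L[ℂ] PiLp 2 (fun _ : Fin d => B.DBR))
      (BR : H →L[ℂ] PiLp 2 (fun _ : Fin d => B.DBR)),
      -- `ι` is the contractive inclusion of the de Branges–Rovnyak space in the Fock space
      ‖ι‖ ≤ 1 ∧ (∀ F : B.DBR, ⇑(ι F) = ⇑F) ∧
      -- the de Branges–Rovnyak space is co-invariant, and `X` is the restriction of `L^* ⊗ I`
      (∀ (F : B.DBR) (j : Fin d), ι (X F j) = (FreeClark.leftCreation H j).adjoint (ι F)) ∧
      -- `BR = (L^* ⊗ I) B^R`
      (∀ (h : H) (j : Fin d),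
        ι (BR h j) = (FreeClark.leftCreation H j).adjoint (B.mulRight (FreeClark.basisEmb H [] h))) ∧
      -- `BR` is the unique contractive Gleason solution for `B^R`
      (∀ A : H →L[ℂ] PiLp 2 (fun _ : Fin d => B.DBR), B.IsContractiveGleason A ↔ A = BR) ∧
      -- the Aleksandrov–Clark map and the weighted Cauchy transform exist and are unique
      (∃! μ : FreeClark.FreeCPMap d H, FreeClark.IsAleksandrovClark B μ) ∧
      ∀ μ : FreeClark.FreeCPMap d H, FreeClark.IsAleksandrovClark B μ →
        (∃! ℱ : μ.FreeHardy ≃ₗᵢ[ℂ] B.DBR, B.IsWeightedCauchyTransform μ ℱ) ∧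
        ∀ ℱ : μ.FreeHardy ≃ₗᵢ[ℂ] B.DBR, B.IsWeightedCauchyTransform μ ℱ →
          -- the Clark intertwining formula, and the perturbation is a co-isometry
          B.clarkOp μ ℱ = X + BR ∘L Ring.inverse (1 - B.right []) ∘L
            (RKHS.kerFun B.DBR []).adjoint ∧
          B.clarkOp μ ℱ ∘L (B.clarkOp μ ℱ).adjoint = 1 :=
  ⟨B.dbrIncl, B.dbrShift, B.gleason, B.norm_dbrIncl_le, B.dbrIncl_apply, B.dbrIncl_dbrShift,
    B.dbrIncl_gleason, B.isContractiveGleason_iff, B.existsUnique_isAleksandrovClark,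
    fun μ hμ => ⟨B.existsUnique_weightedCauchyTransform hμ, fun ℱ hℱ => ⟨B.clarkOp_eq hℱ,
      FreeClark.comp_adjoint_eq_one_of_isometry ℱ
        (LinearIsometryEquiv.piLpCongrRight 2 fun _ : Fin d => ℱ)
        μ.adjoint_rowShift_comp_rowShift⟩⟩⟩
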